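/- Let $R$ be a commutative unital ring. Let $\mathscr{C}_R$ be the following category. Its objects are the pairs $X/G$, where $G$ is a finite group and $X$ is a finite $G$-set. The set of morphisms from $X/G$ to $Y/H$ is $R\otimes_{\mathbb Z}B^{H\times G}(Y\times X)$, where $B^{H\times G}(Y\times X)$ is the Grothendieck group, with respect to disjoint union, of finite $(H\times G)$-sets $U$ equipped with maps $\beta:U\to Y$ and $\alpha:U\to X$ of $(H\times G)$-sets ($H\times G$ acting on $Y$ and on $X$ through its two projections); the class of such a triple is written $\langle U,\beta,\alpha\rangle$. Composition is the $R$-bilinear extension of $$\langle V,\delta,\gamma\rangle\circ\langle U,\beta,\alpha\rangle=\langle V\hat\times_H U,\hat\delta,\hat\alpha\rangle$$ for $\langle U,\beta,\alpha\rangle$ from $X/G$ to $Y/H$ and $\langle V,\delta,\gamma\rangle$ from $Y/H$ to $Z/K$. Here $V\hat\times_H U$ is the set of $H$-orbits $[v,u]$ of $\{(v,u)\in V\times U\mid \gamma(v)=\beta(u)\}$ under $h\cdot(v,u)=((1,h)v,(h,1)u)$, with the $(K\times G)$-action $(k,g)[v,u]=[(k,1)v,(1,g)u]$ and the maps $\hat\delta[v,u]=\delta(v)$,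 $\hat\alpha[v,u]=\alpha(u)$. The identity of $X/G$ is the class of $G\times X$ with the action $(a,b)(g,x)=(agb^{-1},ax)$ and the maps $(g,x)\mapsto x$ (to the target) and $(g,x)\mapsto g^{-1}x$ (to the source). The sum of two objects is $$\frac{X}{G}\oplus\frac{Y}{H}=\frac{(X\times H)\sqcup(G\times Y)}{G\times H},$$ where $G\times H$ acts on $X\times H$ by $(g,h)(x,k)=(gx,hk)$ and on $G\times Y$ by $(g,h)(a,y)=(ga,hy)$. The cancellation law holds for this sum: for all objects $X/G$, $Y/H$ and $Z/L$ of $\mathscr{C}_R$, if $$\frac{X}{G}\oplus\frac{Y}{H}\;\cong\;\frac{X}{G}\oplus\frac{Z}{L}$$ in $\mathscr{C}_R$, then $Y/H\cong Z/L$ in $\mathscr{C}_R$. -/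

import Mathlib

open CategoryTheory TensorProduct

universe u v

/-- A fraction `X/G`: a finite group `G` (`grp`) together with a finite `G`-set `X` (`pts`).
These are the objects of the category `𝒞_R`; the ring `R` is carried along as a parameter so that
the category structure below can depend on it. -/
structure GSetFraction (R : Type v) : Type (max (u + 1) v) where
  grp : Type u
  [group : Group grp]
  [finite_grp : Finite grp]
  pts : Type u
  [act : MulAction grp pts]
  [finite_pts : Finite pts]

namespace GSetFraction

attribute [instance] group finite_grp act finite_pts

variable {R : Type v}

/-- The sum `X/G ⊕ Y/H = ((X × H) ⊔ (G × Y)) / (G × H)`, where `G × H` acts on `X × H` by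
`(g, h) • (x, k) = (g x, h k)` and on `G × Y` by `(g, h) • (a, y) = (g a, h y)`. -/
def oplus (P Q : GSetFraction.{u, v} R) : GSetFraction.{u, v} R where
  grp := P.grp × Q.grp
  pts := (P.pts × Q.grp) ⊕ (P.grp × Q.pts)
  act :=
    { smul := fun a => Sum.map (fun z => (a.1 • z.1, a.2 * z.2)) (fun z => (a.1 * z.1, a.2 • z.2))
      one_smul := by
        rintro (⟨x, k⟩ | ⟨g, y⟩)
        · exact congrArg Sum.inl (Prod.ext (one_smul _ x) (one_mul k))
        · exact congrArg Sum.inr (Prod.ext (one_mul g) (one_smul _ y))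
      mul_smul := by
        rintro a b (⟨x, k⟩ | ⟨g, y⟩)
        · exact congrArg Sum.inl (Prod.ext (mul_smul _ _ x) (mul_assoc _ _ k))
        · exact congrArg Sum.inr (Prod.ext (mul_assoc _ _ g) (mul_smul _ _ y)) }

/-- A finite `(H × G)`-set `U` over `Y × X`, where `P = X/G` and `Q = Y/H`: the maps
`left = β : U → Y` and `right = α : U → X` are morphisms of `(H × G)`-sets, `H × G` acting on `Y`
and on `X` through its two projections. -/
structure GSpan (P Q : GSetFraction.{u, v} R) : Type (u + 1) where
  carrier : Type u
  [finite : Finite carrier]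
  [act : MulAction (Q.grp × P.grp) carrier]
  left : carrier → Q.pts
  right : carrier → P.pts
  left_smul : ∀ (a : Q.grp × P.grp) (x : carrier), left (a • x) = a.1 • left x
  right_smul : ∀ (a : Q.grp × P.grp) (x : carrier), right (a • x) = a.2 • right x

namespace GSpan

attribute [instance] GSpan.finite GSpan.act

variable {P Q S T : GSetFraction.{u, v} R}

/-- Isomorphisms of `(H × G)`-sets over `Y × X`. -/
structure Equivalence (U V : GSpan P Q) where
  toEquiv : U.carrier ≃ V.carrier
  map_smul : ∀ (a : Q.grp × P.grp) (x : U.carrier), toEquiv (a • x) = a • toEquiv x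
  left_eq : ∀ x : U.carrier, V.left (toEquiv x) = U.left x
  right_eq : ∀ x : U.carrier, V.right (toEquiv x) = U.right x

def Equivalence.refl (U : GSpan P Q) : Equivalence U U where
  toEquiv := Equiv.refl _
  map_smul _ _ := rfl
  left_eq _ := rfl
  right_eq _ := rfl

def Equivalence.symm {U V : GSpan P Q} (e : Equivalence U V) : Equivalence V U where
  toEquiv := e.toEquiv.symm
  map_smul a x := by
    rw [Equiv.symm_apply_eq, e.map_smul, Equiv.apply_symm_apply]
  left_eq x := by rw [← e.left_eq, Equiv.apply_symm_apply]
  right_eq x := by rw [← e.right_eq, Equiv.apply_symm_apply]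

def Equivalence.trans {U V W : GSpan P Q} (e : Equivalence U V) (f : Equivalence V W) :
    Equivalence U W where
  toEquiv := e.toEquiv.trans f.toEquiv
  map_smul a x := by simp [e.map_smul, f.map_smul]
  left_eq x := by simp [e.left_eq, f.left_eq]
  right_eq x := by simp [e.right_eq, f.right_eq]

/-- An isomorphism from a common parametrization of the elements of both sides. -/
theorem Equivalence.nonempty_of_surjective {U V : GSpan P Q} {E : Type*} (p : E → U.carrier)
    (q : E → V.carrier) (hp : Function.Surjective p) (hq : Function.Surjective q)
    (hpq : ∀ e e', p e = p e' ↔ q e = q e')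
    (hsmul : ∀ (a : Q.grp × P.grp) e, ∃ e', p e' = a • p e ∧ q e' = a • q e)
    (hleft : ∀ e, V.left (q e) = U.left (p e)) (hright : ∀ e, V.right (q e) = U.right (p e)) :
    Nonempty (Equivalence U V) := by
  have key : ∀ e, q (Function.surjInv hp (p e)) = q e := fun e =>
    (hpq _ _).1 (Function.surjInv_eq hp (p e))
  let e₀ : U.carrier ≃ V.carrier := Equiv.ofBijective (fun x => q (Function.surjInv hp x)) (by
    constructor
    · intro x x' h
      obtain ⟨e, rfl⟩ := hp x
      obtain ⟨e', rfl⟩ := hp x'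
      have h' : q (Function.surjInv hp (p e)) = q (Function.surjInv hp (p e')) := h
      rw [key, key] at h'
      exact (hpq _ _).2 h'
    · intro y
      obtain ⟨e, rfl⟩ := hq y
      exact ⟨p e, key e⟩)
  have he₀ : ∀ e, e₀ (p e) = q e := key
  refine ⟨⟨e₀, ?_, ?_, ?_⟩⟩
  · intro a x
    obtain ⟨e, rfl⟩ := hp x
    obtain ⟨e', h₁, h₂⟩ := hsmul a e
    rw [he₀, ← h₁, ← h₂, he₀]
  · intro x
    obtain ⟨e, rfl⟩ := hp x
    rw [he₀, hleft]
  · intro x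
    obtain ⟨e, rfl⟩ := hp x
    rw [he₀, hright]

instance setoid (P Q : GSetFraction.{u, v} R) : Setoid (GSpan P Q) where
  r U V := Nonempty (Equivalence U V)
  iseqv :=
    { refl := fun U => ⟨Equivalence.refl U⟩
      symm := fun ⟨e⟩ => ⟨e.symm⟩
      trans := fun ⟨e⟩ ⟨f⟩ => ⟨e.trans f⟩ }

/-- The empty `(H × G)`-set over `Y × X`. -/
def empty (P Q : GSetFraction.{u, v} R) : GSpan P Q where
  carrier := PEmpty
  act :=
    { smul := fun _ x => x
      one_smul := fun _ => rfl
      mul_smul := fun _ _ _ => rfl }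
  left := PEmpty.elim
  right := PEmpty.elim
  left_smul _ x := x.elim
  right_smul _ x := x.elim

/-- The disjoint union of `(H × G)`-sets over `Y × X`. -/
def disjUnion (U V : GSpan P Q) : GSpan P Q where
  carrier := U.carrier ⊕ V.carrier
  act :=
    { smul := fun a x => Sum.map (a • ·) (a • ·) x
      one_smul := by
        rintro (x | x)
        · exact congrArg Sum.inl (one_smul _ x)
        · exact congrArg Sum.inr (one_smul _ x)
      mul_smul := by
        rintro a b (x | x)
        · exact congrArg Sum.inl (mul_smul a b x)
        · exact congrArg Sum.inr (mul_smul a b x) }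
  left := Sum.elim U.left V.left
  right := Sum.elim U.right V.right
  left_smul := by
    rintro a (x | x)
    · exact U.left_smul a x
    · exact V.left_smul a x
  right_smul := by
    rintro a (x | x)
    · exact U.right_smul a x
    · exact V.right_smul a x

/-- The identity span of `X/G`: the set `G × X` with the action
`(a, b) • (g, x) = (a g b⁻¹, a x)` and the maps `(g, x) ↦ x` (left) and `(g, x) ↦ g⁻¹ x` (right). -/
def ident (P : GSetFraction.{u, v} R) : GSpan P P where
  carrier := P.grp × P.pts
  act :=
    { smul := fun a x => (a.1 * x.1 * a.2⁻¹, a.1 • x.2)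
      one_smul := by
        rintro ⟨g, x⟩
        change ((1 : P.grp) * g * (1 : P.grp)⁻¹, (1 : P.grp) • x) = _
        simp
      mul_smul := by
        rintro ⟨a, b⟩ ⟨c, d⟩ ⟨g, x⟩
        change ((a * c) * g * (b * d)⁻¹, (a * c) • x) = (a * (c * g * d⁻¹) * b⁻¹, a • c • x)
        rw [mul_smul, mul_inv_rev]
        simp only [mul_assoc] }
  left x := x.2
  right x := x.1⁻¹ • x.2
  left_smul _ _ := rfl
  right_smul := by
    rintro ⟨a, b⟩ ⟨g, x⟩
    change (a * g * b⁻¹)⁻¹ • a • x = b • g⁻¹ • x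
    simp [smul_smul, mul_assoc]

/-- The pullback `W` of `γ : V → Y` and `β : U → Y`. -/
def Pullback (V : GSpan Q T) (U : GSpan P Q) : Type u :=
  {w : V.carrier × U.carrier // V.right w.1 = U.left w.2}

/-- The action of `(k, g) ∈ K × G` and of `h ∈ H` on the pullback, in one formula. With `V` and `U`
seen as bisets, i.e. `(k, h) v = k v h⁻¹` and `(h, g) u = h u g⁻¹`, it is
`(v, u) ↦ (k v h⁻¹, h u g⁻¹)`. -/
def Pullback.move {V : GSpan Q T} {U : GSpan P Q} (k : T.grp) (h : Q.grp) (g : P.grp)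
    (w : Pullback V U) : Pullback V U :=
  ⟨((k, h) • w.1.1, (h, g) • w.1.2), by
    rw [V.right_smul, U.left_smul, w.2]⟩

theorem Pullback.move_move {V : GSpan Q T} {U : GSpan P Q} (k k' : T.grp) (h h' : Q.grp)
    (g g' : P.grp) (w : Pullback V U) :
    Pullback.move k h g (Pullback.move k' h' g' w) =
      Pullback.move (k * k') (h * h') (g * g') w := by
  apply Subtype.ext
  simp [Pullback.move, smul_smul]

theorem Pullback.move_one {V : GSpan Q T} {U : GSpan P Q} (w : Pullback V U) :
    Pullback.move 1 1 1 w = w := by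
  apply Subtype.ext
  apply Prod.ext
  · exact one_smul (T.grp × Q.grp) w.1.1
  · exact one_smul (Q.grp × P.grp) w.1.2

/-- Being in the same `H`-orbit of the pullback. -/
def Pullback.orbitSetoid (V : GSpan Q T) (U : GSpan P Q) : Setoid (Pullback V U) where
  r w w' := ∃ h : Q.grp, Pullback.move 1 h 1 w = w'
  iseqv :=
    { refl := fun w => ⟨1, Pullback.move_one w⟩
      symm := by
        rintro w _ ⟨h, rfl⟩
        exact ⟨h⁻¹, by simp [Pullback.move_move, Pullback.move_one]⟩
      trans := by
        rintro w _ _ ⟨h, rfl⟩ ⟨h', rfl⟩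
        exact ⟨h' * h, by simp [Pullback.move_move]⟩ }

instance Pullback.instFinite (V : GSpan Q T) (U : GSpan P Q) : Finite (Pullback V U) :=
  inferInstanceAs (Finite {w : V.carrier × U.carrier // V.right w.1 = U.left w.2})

/-- The composition `V ∘ U = V ×̂_H U`: the `H`-orbits of the pullback, with the remaining action of
`K × G` and the maps `[v, u] ↦ δ v` (left) and `[v, u] ↦ α u` (right). -/
def comp (V : GSpan Q T) (U : GSpan P Q) : GSpan P T where
  carrier := Quotient (Pullback.orbitSetoid V U)
  act :=
    { smul := fun a => Quotient.map' (s₁ := Pullback.orbitSetoid V U)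
        (s₂ := Pullback.orbitSetoid V U) (Pullback.move a.1 1 a.2) (by
          rintro w _ ⟨h, rfl⟩
          exact ⟨h, by simp [Pullback.move_move]⟩)
      one_smul := by
        rintro ⟨w⟩
        exact congrArg (Quotient.mk (Pullback.orbitSetoid V U)) (Pullback.move_one w)
      mul_smul := by
        rintro a b ⟨w⟩
        refine congrArg (Quotient.mk (Pullback.orbitSetoid V U)) ?_
        simp [Pullback.move_move] }
  left := Quotient.lift (s := Pullback.orbitSetoid V U) (fun w => V.left w.1.1) (by
    rintro w _ ⟨h, rfl⟩
    simp [Pullback.move, V.left_smul])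
  right := Quotient.lift (s := Pullback.orbitSetoid V U) (fun w => U.right w.1.2) (by
    rintro w _ ⟨h, rfl⟩
    simp [Pullback.move, U.right_smul])
  left_smul := by
    rintro a ⟨w⟩
    exact V.left_smul (a.1, 1) w.1.1
  right_smul := by
    rintro a ⟨w⟩
    exact U.right_smul (1, a.2) w.1.2

/-- The class `[v, u]` in `V ×̂_H U`. -/
def comp.mk {V : GSpan Q T} {U : GSpan P Q} (x : V.carrier) (y : U.carrier)
    (h : V.right x = U.left y) : (comp V U).carrier :=
  Quotient.mk (Pullback.orbitSetoid V U) ⟨(x, y), h⟩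

theorem comp.smul_mk {V : GSpan Q T} {U : GSpan P Q} (k : T.grp) (g : P.grp) (x : V.carrier)
    (y : U.carrier) (h : V.right x = U.left y) :
    (k, g) • comp.mk x y h = comp.mk ((k, (1 : Q.grp)) • x) (((1 : Q.grp), g) • y)
      (by rw [V.right_smul, U.left_smul, h]) := rfl

theorem comp.mk_eq_iff {V : GSpan Q T} {U : GSpan P Q} {x x' : V.carrier} {y y' : U.carrier}
    {h : V.right x = U.left y} {h' : V.right x' = U.left y'} :
    comp.mk x y h = comp.mk x' y' h' ↔
      ∃ a : Q.grp, ((1 : T.grp), a) • x = x' ∧ (a, (1 : P.grp)) • y = y' := by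
  refine (Quotient.eq (r := Pullback.orbitSetoid V U)).trans ?_
  refine exists_congr fun a => ?_
  refine Subtype.ext_iff.trans ?_
  exact Prod.ext_iff

theorem comp.exists_rep {V : GSpan Q T} {U : GSpan P Q} (z : (comp V U).carrier) :
    ∃ x y h, z = comp.mk (V := V) (U := U) x y h := by
  obtain ⟨⟨⟨x, y⟩, h⟩⟩ := z
  exact ⟨x, y, h, rfl⟩

theorem comp.left_mk {V : GSpan Q T} {U : GSpan P Q} (x : V.carrier) (y : U.carrier)
    (h : V.right x = U.left y) : (comp V U).left (comp.mk x y h) = V.left x := rfl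

theorem comp.right_mk {V : GSpan Q T} {U : GSpan P Q} (x : V.carrier) (y : U.carrier)
    (h : V.right x = U.left y) : (comp V U).right (comp.mk x y h) = U.right y := rfl

theorem comp_congr {V V' : GSpan Q T} {U U' : GSpan P Q} (hV : V ≈ V') (hU : U ≈ U') :
    comp V U ≈ comp V' U' := by
  obtain ⟨e⟩ := hV
  obtain ⟨f⟩ := hU
  refine Equivalence.nonempty_of_surjective (E := {w : V.carrier × U.carrier //
      V.right w.1 = U.left w.2}) (fun w => comp.mk w.1.1 w.1.2 w.2)
    (fun w => comp.mk (e.toEquiv w.1.1) (f.toEquiv w.1.2) (by rw [e.right_eq, f.left_eq, w.2]))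
    ?_ ?_ ?_ ?_ ?_ ?_
  · intro z
    obtain ⟨x, y, h, rfl⟩ := comp.exists_rep z
    exact ⟨⟨(x, y), h⟩, rfl⟩
  · intro z
    obtain ⟨x, y, h, rfl⟩ := comp.exists_rep z
    obtain ⟨x, rfl⟩ := e.toEquiv.surjective x
    obtain ⟨y, rfl⟩ := f.toEquiv.surjective y
    exact ⟨⟨(x, y), by rw [← e.right_eq, ← f.left_eq, h]⟩, rfl⟩
  · rintro ⟨⟨x, y⟩, h⟩ ⟨⟨x', y'⟩, h'⟩
    simp only [comp.mk_eq_iff, ← e.map_smul, ← f.map_smul, EmbeddingLike.apply_eq_iff_eq]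
  · rintro ⟨k, g⟩ ⟨⟨x, y⟩, h⟩
    exact ⟨⟨((k, 1) • x, (1, g) • y), by rw [V.right_smul, U.left_smul, h]⟩, rfl, by
      simp only [comp.smul_mk, e.map_smul, f.map_smul]⟩
  · rintro ⟨⟨x, y⟩, h⟩
    exact e.left_eq x
  · rintro ⟨⟨x, y⟩, h⟩
    exact f.right_eq y

theorem comp_assoc (W : GSpan S T) (V : GSpan Q S) (U : GSpan P Q) :
    comp (comp W V) U ≈ comp W (comp V U) := by
  refine Equivalence.nonempty_of_surjective
    (E := {w : W.carrier × V.carrier × U.carrier //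
      W.right w.1 = V.left w.2.1 ∧ V.right w.2.1 = U.left w.2.2})
    (fun w => comp.mk (comp.mk w.1.1 w.1.2.1 w.2.1) w.1.2.2
      ((comp.right_mk _ _ _).trans w.2.2))
    (fun w => comp.mk w.1.1 (comp.mk w.1.2.1 w.1.2.2 w.2.2)
      (w.2.1.trans (comp.left_mk _ _ _).symm))
    ?_ ?_ ?_ ?_ ?_ ?_
  · intro z
    obtain ⟨t, u, h, rfl⟩ := comp.exists_rep z
    obtain ⟨x, y, h', rfl⟩ := comp.exists_rep t
    exact ⟨⟨(x, y, u), h', h⟩, rfl⟩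
  · intro z
    obtain ⟨x, t, h, rfl⟩ := comp.exists_rep z
    obtain ⟨y, u, h', rfl⟩ := comp.exists_rep t
    exact ⟨⟨(x, y, u), h, h'⟩, rfl⟩
  · rintro ⟨⟨x, y, u⟩, h₁, h₂⟩ ⟨⟨x', y', u'⟩, h₁', h₂'⟩
    simp only [comp.mk_eq_iff, comp.smul_mk]
    constructor
    · rintro ⟨a, ⟨b, h₃, h₄⟩, h₅⟩
      refine ⟨b, ?_, a, ?_, ?_⟩
      · simpa [smul_smul] using h₃
      · simpa [smul_smul] using h₄
      · simpa [smul_smul] using h₅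
    · rintro ⟨b, h₃, a, h₄, h₅⟩
      refine ⟨a, ⟨b, ?_, ?_⟩, ?_⟩
      · simpa [smul_smul] using h₃
      · simpa [smul_smul] using h₄
      · simpa [smul_smul] using h₅
  · rintro ⟨k, g⟩ ⟨⟨x, y, u⟩, h₁, h₂⟩
    have hy : ((1 : S.grp), (1 : Q.grp)) • y = y := one_smul (S.grp × Q.grp) y
    refine ⟨⟨((k, (1 : S.grp)) • x, y, ((1 : Q.grp), g) • u),
      ((W.right_smul _ _).trans (one_smul _ _)).trans h₁,
      h₂.trans ((U.left_smul _ _).trans (one_smul _ _)).symm⟩, ?_, ?_⟩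
    · simp only [comp.smul_mk, hy]
    · simp only [comp.smul_mk, hy]
  · rintro ⟨⟨x, y, u⟩, h₁, h₂⟩
    rfl
  · rintro ⟨⟨x, y, u⟩, h₁, h₂⟩
    rfl

/-- The element `(g, x)` of the identity span. -/
def ident.mk {P : GSetFraction.{u, v} R} (g : P.grp) (x : P.pts) : (ident P).carrier := (g, x)

theorem ident.smul_mk (a b g : P.grp) (x : P.pts) :
    (a, b) • ident.mk g x = ident.mk (a * g * b⁻¹) (a • x) := rfl

theorem ident.left_mk (g : P.grp) (x : P.pts) : (ident P).left (ident.mk g x) = x := rfl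

theorem ident.right_mk (g : P.grp) (x : P.pts) :
    (ident P).right (ident.mk g x) = g⁻¹ • x := rfl

theorem ident.mk_eq_iff {g g' : P.grp} {x x' : P.pts} :
    ident.mk g x = ident.mk g' x' ↔ g = g' ∧ x = x' := Prod.ext_iff

theorem ident.exists_rep (z : (ident P).carrier) : ∃ g x, z = ident.mk g x := ⟨z.1, z.2, rfl⟩

theorem comp_ident (U : GSpan P Q) : comp U (ident P) ≈ U := by
  refine Equivalence.nonempty_of_surjective (E := P.grp × U.carrier)
    (fun w => comp.mk w.2 (ident.mk w.1 (U.right w.2)) (ident.left_mk _ _).symm)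
    (fun w => ((1 : Q.grp), w.1⁻¹) • w.2) ?_ ?_ ?_ ?_ ?_ ?_
  · intro z
    obtain ⟨x, t, h, rfl⟩ := comp.exists_rep z
    obtain ⟨g, y, rfl⟩ := ident.exists_rep t
    obtain rfl : U.right x = y := h
    exact ⟨(g, x), rfl⟩
  · intro x
    refine ⟨(1, x), ?_⟩
    simp only [inv_one]
    exact one_smul (Q.grp × P.grp) x
  · rintro ⟨g, x⟩ ⟨g', x'⟩
    simp only [comp.mk_eq_iff, ident.smul_mk, ident.mk_eq_iff]
    constructor
    · rintro ⟨a, rfl, rfl, -⟩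
      simp [smul_smul]
    · intro h
      have h₁ : ((1 : Q.grp), g' * g⁻¹) • x = x' := by
        have := congrArg (fun y => ((1 : Q.grp), g') • y) h
        simp only [smul_smul, Prod.mk_mul_mk, mul_one, mul_inv_cancel] at this
        exact this.trans (one_smul (Q.grp × P.grp) x')
      exact ⟨g' * g⁻¹, h₁, by simp, by rw [← h₁, U.right_smul]⟩
  · rintro ⟨k, g⟩ ⟨a, x⟩
    refine ⟨(a * g⁻¹, (k, (1 : P.grp)) • x), ?_, ?_⟩
    · simp only [comp.smul_mk, ident.smul_mk, U.right_smul, one_smul, one_mul]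
    · simp [smul_smul]
  · rintro ⟨g, x⟩
    simp [U.left_smul, comp.left_mk]
  · rintro ⟨g, x⟩
    simp [U.right_smul, comp.right_mk, ident.right_mk]

theorem ident_comp (U : GSpan P Q) : comp (ident Q) U ≈ U := by
  refine Equivalence.nonempty_of_surjective (E := Q.grp × U.carrier)
    (fun w => comp.mk (ident.mk w.1 (w.1 • U.left w.2)) w.2
      ((ident.right_mk _ _).trans (inv_smul_smul _ _)))
    (fun w => (w.1, (1 : P.grp)) • w.2) ?_ ?_ ?_ ?_ ?_ ?_
  · intro z
    obtain ⟨t, x, h, rfl⟩ := comp.exists_rep z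
    obtain ⟨g, y, rfl⟩ := ident.exists_rep t
    obtain rfl : y = g • U.left x := by rw [← h, ident.right_mk, smul_inv_smul]
    exact ⟨(g, x), rfl⟩
  · intro x
    exact ⟨(1, x), one_smul (Q.grp × P.grp) x⟩
  · rintro ⟨g, x⟩ ⟨g', x'⟩
    simp only [comp.mk_eq_iff, ident.smul_mk, ident.mk_eq_iff]
    constructor
    · rintro ⟨a, ⟨rfl, -⟩, rfl⟩
      simp [smul_smul]
    · intro h
      have h₁ : (g'⁻¹ * g, (1 : P.grp)) • x = x' := by
        have := congrArg (fun y => (g'⁻¹, (1 : P.grp)) • y) h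
        simp only [smul_smul, Prod.mk_mul_mk, mul_one, inv_mul_cancel] at this
        exact this.trans (one_smul (Q.grp × P.grp) x')
      exact ⟨g'⁻¹ * g, ⟨by simp, by simp [← h₁, U.left_smul, smul_smul]⟩, h₁⟩
  · rintro ⟨k, g⟩ ⟨a, x⟩
    refine ⟨(k * a, ((1 : Q.grp), g) • x), ?_, ?_⟩
    · simp only [comp.smul_mk, ident.smul_mk, U.left_smul, one_smul, smul_smul, inv_one, mul_one]
    · simp [smul_smul]
  · rintro ⟨g, x⟩
    simp [U.left_smul, comp.left_mk, ident.left_mk]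
  · rintro ⟨g, x⟩
    simp [U.right_smul, comp.right_mk]

theorem disjUnion_congr {U U' V V' : GSpan P Q} (hU : U ≈ U') (hV : V ≈ V') :
    disjUnion U V ≈ disjUnion U' V' := by
  obtain ⟨e⟩ := hU
  obtain ⟨f⟩ := hV
  refine ⟨⟨Equiv.sumCongr e.toEquiv f.toEquiv, ?_, ?_, ?_⟩⟩
  · rintro a (x | x)
    · exact congrArg Sum.inl (e.map_smul a x)
    · exact congrArg Sum.inr (f.map_smul a x)
  · rintro (x | x)
    · exact e.left_eq x
    · exact f.left_eq x
  · rintro (x | x)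
    · exact e.right_eq x
    · exact f.right_eq x

theorem disjUnion_assoc (U V W : GSpan P Q) :
    disjUnion (disjUnion U V) W ≈ disjUnion U (disjUnion V W) := by
  refine ⟨⟨Equiv.sumAssoc _ _ _, ?_, ?_, ?_⟩⟩
  · rintro a ((x | x) | x) <;> rfl
  · rintro ((x | x) | x) <;> rfl
  · rintro ((x | x) | x) <;> rfl

theorem disjUnion_comm (U V : GSpan P Q) : disjUnion U V ≈ disjUnion V U := by
  refine ⟨⟨Equiv.sumComm _ _, ?_, ?_, ?_⟩⟩
  · rintro a (x | x) <;> rfl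
  · rintro (x | x) <;> rfl
  · rintro (x | x) <;> rfl

theorem empty_disjUnion (U : GSpan P Q) : disjUnion (empty P Q) U ≈ U := by
  refine ⟨⟨Equiv.emptySum PEmpty U.carrier, ?_, ?_, ?_⟩⟩
  · rintro a (x | x)
    · exact x.elim
    · rfl
  · rintro (x | x)
    · exact x.elim
    · rfl
  · rintro (x | x)
    · exact x.elim
    · rfl

theorem empty_comp (U : GSpan P Q) : comp (empty Q T) U ≈ empty P T := by
  have h : ∀ z : (comp (empty Q T) U).carrier, False := fun z => by
    obtain ⟨x, -⟩ := comp.exists_rep z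
    exact x.elim
  exact ⟨⟨⟨fun z => (h z).elim, fun z => z.elim, fun z => (h z).elim, fun z => z.elim⟩,
    fun _ z => (h z).elim, fun z => (h z).elim, fun z => (h z).elim⟩⟩

theorem comp_empty (V : GSpan Q T) : comp V (empty P Q) ≈ empty P T := by
  have h : ∀ z : (comp V (empty P Q)).carrier, False := fun z => by
    obtain ⟨-, x, -⟩ := comp.exists_rep z
    exact x.elim
  exact ⟨⟨⟨fun z => (h z).elim, fun z => z.elim, fun z => (h z).elim, fun z => z.elim⟩,
    fun _ z => (h z).elim, fun z => (h z).elim, fun z => (h z).elim⟩⟩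

/-- The two inclusions into a disjoint union. -/
def disjUnion.inl {U V : GSpan P Q} (x : U.carrier) : (disjUnion U V).carrier := Sum.inl x

def disjUnion.inr {U V : GSpan P Q} (x : V.carrier) : (disjUnion U V).carrier := Sum.inr x

theorem disjUnion.smul_inl {U V : GSpan P Q} (a : Q.grp × P.grp) (x : U.carrier) :
    a • disjUnion.inl (V := V) x = disjUnion.inl (a • x) := rfl

theorem disjUnion.smul_inr {U V : GSpan P Q} (a : Q.grp × P.grp) (x : V.carrier) :
    a • disjUnion.inr (U := U) x = disjUnion.inr (a • x) := rfl

theorem disjUnion.inl_inj {U V : GSpan P Q} {x y : U.carrier} :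
    disjUnion.inl (V := V) x = disjUnion.inl y ↔ x = y := Sum.inl_injective.eq_iff

theorem disjUnion.inr_inj {U V : GSpan P Q} {x y : V.carrier} :
    disjUnion.inr (U := U) x = disjUnion.inr y ↔ x = y := Sum.inr_injective.eq_iff

theorem disjUnion.inl_ne_inr {U V : GSpan P Q} (x : U.carrier) (y : V.carrier) :
    disjUnion.inl (V := V) x ≠ disjUnion.inr y := Sum.inl_ne_inr

theorem disjUnion.exists_rep {U V : GSpan P Q} (z : (disjUnion U V).carrier) :
    (∃ x, z = disjUnion.inl x) ∨ ∃ x, z = disjUnion.inr x := by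
  rcases z with x | x
  · exact Or.inl ⟨x, rfl⟩
  · exact Or.inr ⟨x, rfl⟩

theorem disjUnion_comp (V V' : GSpan Q T) (U : GSpan P Q) :
    comp (disjUnion V V') U ≈ disjUnion (comp V U) (comp V' U) := by
  refine Equivalence.nonempty_of_surjective
    (E := {w : V.carrier × U.carrier // V.right w.1 = U.left w.2} ⊕
      {w : V'.carrier × U.carrier // V'.right w.1 = U.left w.2})
    (Sum.elim (fun w => comp.mk (disjUnion.inl w.1.1) w.1.2 w.2)
      (fun w => comp.mk (disjUnion.inr w.1.1) w.1.2 w.2))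
    (Sum.elim (fun w => disjUnion.inl (comp.mk w.1.1 w.1.2 w.2))
      (fun w => disjUnion.inr (comp.mk w.1.1 w.1.2 w.2))) ?_ ?_ ?_ ?_ ?_ ?_
  · intro z
    obtain ⟨t, y, h, rfl⟩ := comp.exists_rep z
    obtain ⟨x, rfl⟩ | ⟨x, rfl⟩ := disjUnion.exists_rep t
    · exact ⟨Sum.inl ⟨(x, y), h⟩, rfl⟩
    · exact ⟨Sum.inr ⟨(x, y), h⟩, rfl⟩
  · intro z
    obtain ⟨t, rfl⟩ | ⟨t, rfl⟩ := disjUnion.exists_rep z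
    · obtain ⟨x, y, h, rfl⟩ := comp.exists_rep t
      exact ⟨Sum.inl ⟨(x, y), h⟩, rfl⟩
    · obtain ⟨x, y, h, rfl⟩ := comp.exists_rep t
      exact ⟨Sum.inr ⟨(x, y), h⟩, rfl⟩
  · rintro (⟨⟨x, y⟩, h⟩ | ⟨⟨x, y⟩, h⟩) (⟨⟨x', y'⟩, h'⟩ | ⟨⟨x', y'⟩, h'⟩) <;>
      refine (comp.mk_eq_iff).trans ?_ <;>
      simp only [Sum.elim_inl, Sum.elim_inr, comp.mk_eq_iff, disjUnion.smul_inl,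
        disjUnion.smul_inr, disjUnion.inl_inj, disjUnion.inr_inj, disjUnion.inl_ne_inr,
        (disjUnion.inl_ne_inr _ _).symm, false_and, exists_false]
  · rintro ⟨k, g⟩ (⟨⟨x, y⟩, h⟩ | ⟨⟨x, y⟩, h⟩)
    · exact ⟨Sum.inl ⟨((k, 1) • x, (1, g) • y), by rw [V.right_smul, U.left_smul, h]⟩, rfl, rfl⟩
    · exact ⟨Sum.inr ⟨((k, 1) • x, (1, g) • y), by rw [V'.right_smul, U.left_smul, h]⟩, rfl, rfl⟩
  · rintro (w | w) <;> rfl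
  · rintro (w | w) <;> rfl

theorem comp_disjUnion (V : GSpan Q T) (U U' : GSpan P Q) :
    comp V (disjUnion U U') ≈ disjUnion (comp V U) (comp V U') := by
  refine Equivalence.nonempty_of_surjective
    (E := {w : V.carrier × U.carrier // V.right w.1 = U.left w.2} ⊕
      {w : V.carrier × U'.carrier // V.right w.1 = U'.left w.2})
    (Sum.elim (fun w => comp.mk w.1.1 (disjUnion.inl w.1.2) w.2)
      (fun w => comp.mk w.1.1 (disjUnion.inr w.1.2) w.2))
    (Sum.elim (fun w => disjUnion.inl (comp.mk w.1.1 w.1.2 w.2))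
      (fun w => disjUnion.inr (comp.mk w.1.1 w.1.2 w.2))) ?_ ?_ ?_ ?_ ?_ ?_
  · intro z
    obtain ⟨x, t, h, rfl⟩ := comp.exists_rep z
    obtain ⟨y, rfl⟩ | ⟨y, rfl⟩ := disjUnion.exists_rep t
    · exact ⟨Sum.inl ⟨(x, y), h⟩, rfl⟩
    · exact ⟨Sum.inr ⟨(x, y), h⟩, rfl⟩
  · intro z
    obtain ⟨t, rfl⟩ | ⟨t, rfl⟩ := disjUnion.exists_rep z
    · obtain ⟨x, y, h, rfl⟩ := comp.exists_rep t
      exact ⟨Sum.inl ⟨(x, y), h⟩, rfl⟩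
    · obtain ⟨x, y, h, rfl⟩ := comp.exists_rep t
      exact ⟨Sum.inr ⟨(x, y), h⟩, rfl⟩
  · rintro (⟨⟨x, y⟩, h⟩ | ⟨⟨x, y⟩, h⟩) (⟨⟨x', y'⟩, h'⟩ | ⟨⟨x', y'⟩, h'⟩) <;>
      refine (comp.mk_eq_iff).trans ?_ <;>
      simp only [Sum.elim_inl, Sum.elim_inr, comp.mk_eq_iff, disjUnion.smul_inl,
        disjUnion.smul_inr, disjUnion.inl_inj, disjUnion.inr_inj, disjUnion.inl_ne_inr,
        (disjUnion.inl_ne_inr _ _).symm, and_false, exists_false]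
  · rintro ⟨k, g⟩ (⟨⟨x, y⟩, h⟩ | ⟨⟨x, y⟩, h⟩)
    · exact ⟨Sum.inl ⟨((k, 1) • x, (1, g) • y), by rw [V.right_smul, U.left_smul, h]⟩, rfl, rfl⟩
    · exact ⟨Sum.inr ⟨((k, 1) • x, (1, g) • y), by rw [V.right_smul, U'.left_smul, h]⟩, rfl, rfl⟩
  · rintro (w | w) <;> rfl
  · rintro (w | w) <;> rfl

end GSpan

/-- Isomorphism classes of finite `(H × G)`-sets over `Y × X`. -/
def SpanClass (P Q : GSetFraction.{u, v} R) : Type (u + 1) := Quotient (GSpan.setoid P Q)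

namespace SpanClass

variable {P Q S T : GSetFraction.{u, v} R}

/-- The isomorphism class of a span. -/
def mk (U : GSpan P Q) : SpanClass P Q := Quotient.mk (GSpan.setoid P Q) U

instance (P Q : GSetFraction.{u, v} R) : Add (SpanClass P Q) where
  add := Quotient.map₂ GSpan.disjUnion fun _ _ h _ _ h' => GSpan.disjUnion_congr h h'

instance (P Q : GSetFraction.{u, v} R) : Zero (SpanClass P Q) where
  zero := mk (GSpan.empty P Q)

theorem mk_add (U V : GSpan P Q) : mk U + mk V = mk (GSpan.disjUnion U V) := rfl

theorem zero_def : (0 : SpanClass P Q) = mk (GSpan.empty P Q) := rfl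

theorem mk_eq_iff {U V : GSpan P Q} : mk U = mk V ↔ U ≈ V := Quotient.eq

theorem exists_rep (x : SpanClass P Q) : ∃ U, x = mk U := by
  obtain ⟨U⟩ := x
  exact ⟨U, rfl⟩

/-- Isomorphism classes form a commutative monoid under disjoint union. -/
instance (P Q : GSetFraction.{u, v} R) : AddCommMonoid (SpanClass P Q) where
  add_assoc := by
    rintro ⟨U⟩ ⟨V⟩ ⟨W⟩
    exact Quotient.sound (GSpan.disjUnion_assoc U V W)
  add_comm := by
    rintro ⟨U⟩ ⟨V⟩
    exact Quotient.sound (GSpan.disjUnion_comm U V)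
  zero_add := by
    rintro ⟨U⟩
    exact Quotient.sound (GSpan.empty_disjUnion U)
  add_zero := by
    rintro ⟨U⟩
    exact Quotient.sound
      (Setoid.trans (GSpan.disjUnion_comm U (GSpan.empty P Q)) (GSpan.empty_disjUnion U))
  nsmul := nsmulRec

/-- Composition of isomorphism classes, `⟨V⟩ ∘ ⟨U⟩ = ⟨V ×̂_H U⟩`; it is biadditive. -/
def comp (P Q T : GSetFraction.{u, v} R) : SpanClass Q T →+ SpanClass P Q →+ SpanClass P T where
  toFun y :=
    { toFun := fun x => Quotient.map₂ GSpan.comp (fun _ _ h _ _ h' => GSpan.comp_congr h h') y x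
      map_zero' := by
        obtain ⟨V⟩ := y
        exact Quotient.sound (GSpan.comp_empty V)
      map_add' := by
        obtain ⟨V⟩ := y
        rintro ⟨U⟩ ⟨U'⟩
        exact Quotient.sound (GSpan.comp_disjUnion V U U') }
  map_zero' := by
    ext x
    obtain ⟨U⟩ := x
    exact Quotient.sound (GSpan.empty_comp U)
  map_add' := by
    rintro ⟨V⟩ ⟨V'⟩
    ext x
    obtain ⟨U⟩ := x
    exact Quotient.sound (GSpan.disjUnion_comp V V' U)

theorem comp_mk (V : GSpan Q T) (U : GSpan P Q) :
    comp P Q T (mk V) (mk U) = mk (GSpan.comp V U) := rfl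

end SpanClass

/-- The Burnside group `B^{H × G}(Y × X)`: the Grothendieck group of finite `(H × G)`-sets over
`Y × X` with respect to disjoint union. -/
abbrev Burnside (P Q : GSetFraction.{u, v} R) : Type (u + 1) :=
  Algebra.GrothendieckAddGroup (SpanClass P Q)

namespace Burnside

variable {P Q S T : GSetFraction.{u, v} R}

/-- The generator `⟨U, β, α⟩`. -/
noncomputable def of (U : GSpan P Q) : Burnside P Q :=
  Algebra.GrothendieckAddGroup.of (SpanClass.mk U)

theorem hom_ext {A : Type*} [AddCommGroup A] {f g : Burnside P Q →+ A}
    (h : ∀ U, f (of U) = g (of U)) : f = g := by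
  apply Algebra.GrothendieckAddGroup.lift.symm.injective
  ext x
  obtain ⟨U, rfl⟩ := SpanClass.exists_rep x
  exact h U

theorem lift_of {A : Type*} [AddCommGroup A] (f : SpanClass P Q →+ A) (x : SpanClass P Q) :
    Algebra.GrothendieckAddGroup.lift f (Algebra.GrothendieckAddGroup.of x) = f x :=
  DFunLike.congr_fun (Algebra.GrothendieckAddGroup.lift.symm_apply_apply f) x

/-- The biadditive extension of the composition to Burnside groups. -/
noncomputable def comp (P Q T : GSetFraction.{u, v} R) :
    Burnside Q T →+ Burnside P Q →+ Burnside P T :=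
  Algebra.GrothendieckAddGroup.lift
    { toFun := fun y => Algebra.GrothendieckAddGroup.lift
        (Algebra.GrothendieckAddGroup.of.comp (SpanClass.comp P Q T y))
      map_zero' := by
        refine hom_ext fun U => ?_
        simp only [of, lift_of, map_zero, AddMonoidHom.comp_zero, AddMonoidHom.zero_apply]
      map_add' := fun y y' => by
        refine hom_ext fun U => ?_
        simp only [of, lift_of, map_add, AddMonoidHom.add_apply, AddMonoidHom.comp_apply] }

theorem comp_of (V : GSpan Q T) (U : GSpan P Q) :
    comp P Q T (of V) (of U) = of (GSpan.comp V U) := by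
  refine (DFunLike.congr_fun (lift_of _ (SpanClass.mk V)) (of U)).trans ?_
  exact lift_of _ (SpanClass.mk U)

theorem of_eq {U V : GSpan P Q} (h : U ≈ V) : of U = of V :=
  congrArg Algebra.GrothendieckAddGroup.of (SpanClass.mk_eq_iff.2 h)

@[elab_as_elim]
theorem induction {p : Burnside P Q → Prop} (hof : ∀ U, p (of U))
    (hsub : ∀ x y, p x → p y → p (x - y)) (x : Burnside P Q) : p x := by
  induction x using AddLocalization.ind with
  | _ y =>
    obtain ⟨a, b, hb⟩ := y
    obtain ⟨U, rfl⟩ := SpanClass.exists_rep a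
    obtain ⟨V, rfl⟩ := SpanClass.exists_rep b
    have : (AddLocalization.mk (SpanClass.mk U) ⟨SpanClass.mk V, hb⟩ : Burnside P Q) =
        of U - of V := by
      change _ = AddLocalization.addMonoidOf ⊤ _ - AddLocalization.addMonoidOf ⊤ _
      rw [← AddLocalization.mk_zero_eq_addMonoidOf_mk, ← AddLocalization.mk_zero_eq_addMonoidOf_mk,
        Algebra.GrothendieckAddGroup.mk_sub_mk]
      simp
    rw [this]
    exact hsub _ _ (hof U) (hof V)

theorem comp_assoc (z : Burnside S T) (y : Burnside Q S) (x : Burnside P Q) :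
    comp P Q T (comp Q S T z y) x = comp P S T z (comp P Q S y x) := by
  induction z using induction with
  | hsub z z' hz hz' => simp only [map_sub, AddMonoidHom.sub_apply, hz, hz']
  | hof W =>
    induction y using induction with
    | hsub y y' hy hy' => simp only [map_sub, AddMonoidHom.sub_apply, hy, hy']
    | hof V =>
      induction x using induction with
      | hsub x x' hx hx' => simp only [map_sub, hx, hx']
      | hof U =>
        simp only [comp_of]
        exact of_eq (GSpan.comp_assoc W V U)

theorem comp_ident (x : Burnside P Q) : comp P P Q x (of (GSpan.ident P)) = x := by
  induction x using induction with
  | hsub x x' hx hx' => simp only [map_sub, AddMonoidHom.sub_apply, hx, hx']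
  | hof U =>
    rw [comp_of]
    exact of_eq (GSpan.comp_ident U)

theorem ident_comp (x : Burnside P Q) : comp P Q Q (of (GSpan.ident Q)) x = x := by
  induction x using induction with
  | hsub x x' hx hx' => simp only [map_sub, hx, hx']
  | hof U =>
    rw [comp_of]
    exact of_eq (GSpan.ident_comp U)

/-- The composition of Burnside groups as a `ℤ`-bilinear map. -/
noncomputable def compLinear (P Q T : GSetFraction.{u, v} R) :
    Burnside Q T →ₗ[ℤ] Burnside P Q →ₗ[ℤ] Burnside P T :=
  LinearMap.mk₂ ℤ (fun y x => comp P Q T y x)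
    (fun y y' x => by rw [map_add, AddMonoidHom.add_apply])
    (fun n y x => by rw [map_zsmul, AddMonoidHom.zsmul_apply])
    (fun y x x' => map_add _ x x')
    (fun n y x => map_zsmul _ n x)

end Burnside

variable [CommRing R]

/-- The morphisms `X/G ⟶ Y/H` of `𝒞_R`: the `R`-module `R ⊗_ℤ B^{H × G}(Y × X)`. -/
abbrev Mor (P Q : GSetFraction.{u, v} R) : Type (max (u + 1) v) := R ⊗[ℤ] Burnside P Q

/-- The bilinear composition of `𝒞_R`,
`(s ⊗ ⟨V⟩) ∘ (r ⊗ ⟨U⟩) = s r ⊗ ⟨V ×̂_H U⟩`. -/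
noncomputable def Mor.comp {P Q T : GSetFraction.{u, v} R} (g : Mor Q T) (f : Mor P Q) : Mor P T :=
  TensorProduct.map₂ (LinearMap.mul ℤ R) (Burnside.compLinear P Q T) g f

theorem Mor.comp_tmul {P Q T : GSetFraction.{u, v} R} (s r : R) (y : Burnside Q T)
    (x : Burnside P Q) :
    Mor.comp (s ⊗ₜ[ℤ] y) (r ⊗ₜ[ℤ] x) = (s * r) ⊗ₜ[ℤ] Burnside.comp P Q T y x := rfl

theorem Mor.comp_add {P Q T : GSetFraction.{u, v} R} (g : Mor Q T) (f f' : Mor P Q) :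
    Mor.comp g (f + f') = Mor.comp g f + Mor.comp g f' := map_add _ f f'

theorem Mor.add_comp {P Q T : GSetFraction.{u, v} R} (g g' : Mor Q T) (f : Mor P Q) :
    Mor.comp (g + g') f = Mor.comp g f + Mor.comp g' f := LinearMap.map_add₂ _ g g' f

theorem Mor.comp_zero {P Q T : GSetFraction.{u, v} R} (g : Mor Q T) :
    Mor.comp g (0 : Mor P Q) = 0 := map_zero _

theorem Mor.zero_comp {P Q T : GSetFraction.{u, v} R} (f : Mor P Q) :
    Mor.comp (0 : Mor Q T) f = 0 := LinearMap.map_zero₂ _ f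

/-- The category `𝒞_R`. -/
noncomputable instance category : Category.{max (u + 1) v} (GSetFraction.{u, v} R) where
  Hom := Mor
  id P := (1 : R) ⊗ₜ[ℤ] Burnside.of (GSpan.ident P)
  comp f g := Mor.comp g f
  id_comp {P Q} f := by
    induction f using TensorProduct.induction_on with
    | zero => exact Mor.zero_comp _
    | add f f' h h' => rw [Mor.add_comp, h, h']
    | tmul r x => rw [Mor.comp_tmul, mul_one, Burnside.comp_ident]
  comp_id {P Q} f := by
    induction f using TensorProduct.induction_on with
    | zero => exact Mor.comp_zero _
    | add f f' h h' => rw [Mor.comp_add, h, h']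
    | tmul r x => rw [Mor.comp_tmul, one_mul, Burnside.ident_comp]
  assoc {P Q S T} f g h := by
    induction f using TensorProduct.induction_on with
    | zero => simp only [Mor.comp_zero]
    | add f f' h h' => simp only [Mor.comp_add, h, h']
    | tmul r x =>
      induction g using TensorProduct.induction_on with
      | zero => simp only [Mor.comp_zero, Mor.zero_comp]
      | add g g' h h' => simp only [Mor.comp_add, Mor.add_comp, h, h']
      | tmul s y =>
        induction h using TensorProduct.induction_on with
        | zero => simp only [Mor.zero_comp]
        | add h h' e e' => simp only [Mor.add_comp, e, e']
        | tmul t z => simp only [Mor.comp_tmul, Burnside.comp_assoc, mul_assoc]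

end GSetFraction

/-! A fraction `Q` behaves in `𝒞_R` like the action groupoid of its points. A full embedding of
action groupoids gives a covariant span `push` and a contravariant span `pull`. One composite is the
identity (`FullEmbedding.pull_comp_push`), the other is the part of the identity of the target that
lies over the orbits met by the image (`FullEmbedding.push_comp_pull`). Hence embeddings that
together meet each orbit exactly once exhibit the target as a biproduct. It follows that `P.oplus Q`
is a biproduct of `P` and `Q`, and that `Q` is the biproduct over its orbits of the one-point
fractions `•/K`, with `K` the stabilizer.

For cancellation it remains to recover, from the isomorphism class of `Q`, how often each `K` occurs
as a stabilizer. No Krull–Schmidt property is available over a general `R`, so the multiplicities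
are read off from ranks. If `R` is nonzero, choose a homomorphism `φ` to a residue field. On the
endomorphisms of `•/K`, take the additive functional that counts the orbits of a biset whose
stabilizer is the graph of an automorphism of `K`, weighted by `φ`. For each object `X` it gives a
pairing of `K ⟶ X` with `X ⟶ K` through composition. The rank of this pairing is finite, invariant
under isomorphism, and additive on biproducts.

A counted orbit cannot factor through a group `G` with `|G| ≤ |K|` unless `G ≅ K`
(`GSpan.nonempty_mulEquiv_of_isTwisted`), so the rank at `•/G` is zero for such `G ≇ K`. It is
positive at `•/K`, since the identity counts one. The ranks are therefore triangular in the
multiplicities and determine them (`multiset_eq_of_triangular`). Since ranks are natural numbers,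
the contribution of `P` cancels. -/

namespace GSetFraction

variable {R : Type v}

/-! ### Splitting spans along invariant functions -/

namespace GSpan

variable {P Q S T : GSetFraction.{u, v} R}

/-- The sub-span on an invariant subset. -/
def restrict (U : GSpan P Q) (s : Set U.carrier) (hs : ∀ (a : Q.grp × P.grp), ∀ x ∈ s, a • x ∈ s) :
    GSpan P Q where
  carrier := s
  act :=
    { smul := fun a x => ⟨a • x.1, hs a x.1 x.2⟩
      one_smul := fun x => Subtype.ext (one_smul _ x.1)
      mul_smul := fun a b x => Subtype.ext (mul_smul a b x.1) }
  left x := U.left x.1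
  right x := U.right x.1
  left_smul a x := U.left_smul a x.1
  right_smul a x := U.right_smul a x.1

/-- The fibres of an invariant function on a span, over a set of values. -/
def fibers (U : GSpan P Q) {ι : Type*} (c : U.carrier → ι)
    (hc : ∀ (a : Q.grp × P.grp) x, c (a • x) = c x) (t : Set ι) : GSpan P Q :=
  U.restrict (c ⁻¹' t) fun a x hx => by rwa [Set.mem_preimage, hc]

section fibers

variable {ι : Type*} {U : GSpan P Q} {c : U.carrier → ι}
  {hc : ∀ (a : Q.grp × P.grp) x, c (a • x) = c x}

def fibers.mk {t : Set ι} (x : U.carrier) (hx : c x ∈ t) : (U.fibers c hc t).carrier := ⟨x, hx⟩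

theorem fibers.exists_rep {t : Set ι} (z : (U.fibers c hc t).carrier) :
    ∃ x hx, z = fibers.mk x hx := ⟨z.1, z.2, rfl⟩

theorem fibers.mk_eq_iff {t : Set ι} {x y : U.carrier} {hx : c x ∈ t} {hy : c y ∈ t} :
    (fibers.mk x hx : (U.fibers c hc t).carrier) = fibers.mk y hy ↔ x = y := Subtype.ext_iff

theorem fibers.smul_mk {t : Set ι} (a : Q.grp × P.grp) (x : U.carrier) (hx : c x ∈ t) :
    a • (fibers.mk x hx : (U.fibers c hc t).carrier) =
      fibers.mk (a • x) (by rwa [hc]) := rfl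

theorem fibers_univ : U.fibers c hc Set.univ ≈ U :=
  ⟨⟨⟨fun x => x.1, fun x => ⟨x, trivial⟩, fun _ => rfl, fun _ => rfl⟩, fun _ _ => rfl,
    fun _ => rfl, fun _ => rfl⟩⟩

theorem equiv_empty_of_isEmpty (U : GSpan P Q) (h : ∀ _ : U.carrier, False) : U ≈ empty P Q :=
  ⟨⟨⟨fun z => (h z).elim, fun z => z.elim, fun z => (h z).elim, fun z => z.elim⟩,
    fun _ z => (h z).elim, fun z => (h z).elim, fun z => (h z).elim⟩⟩

theorem fibers_empty : U.fibers c hc ∅ ≈ empty P Q :=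
  equiv_empty_of_isEmpty _ fun z => z.2

theorem fibers_insert {i : ι} {t : Set ι} (hi : i ∉ t) :
    U.fibers c hc (insert i t) ≈ disjUnion (U.fibers c hc {i}) (U.fibers c hc t) := by
  refine Equivalence.nonempty_of_surjective
    (E := {x // c x = i} ⊕ {x // c x ∈ t})
    (Sum.elim (fun x => fibers.mk x.1 (Or.inl x.2)) (fun x => fibers.mk x.1 (Or.inr x.2)))
    (Sum.elim (fun x => disjUnion.inl (fibers.mk x.1 x.2))
      (fun x => disjUnion.inr (fibers.mk x.1 x.2))) ?_ ?_ ?_ ?_ ?_ ?_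
  · rintro ⟨x, hx | hx⟩
    · exact ⟨Sum.inl ⟨x, hx⟩, rfl⟩
    · exact ⟨Sum.inr ⟨x, hx⟩, rfl⟩
  · intro z
    obtain ⟨⟨x, hx⟩, rfl⟩ | ⟨⟨x, hx⟩, rfl⟩ := disjUnion.exists_rep z
    · exact ⟨Sum.inl ⟨x, hx⟩, rfl⟩
    · exact ⟨Sum.inr ⟨x, hx⟩, rfl⟩
  · rintro (⟨x, hx⟩ | ⟨x, hx⟩) (⟨y, hy⟩ | ⟨y, hy⟩) <;>
      simp only [Sum.elim_inl, Sum.elim_inr]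
    · exact (fibers.mk_eq_iff.trans fibers.mk_eq_iff.symm).trans disjUnion.inl_inj.symm
    · refine fibers.mk_eq_iff.trans (iff_of_false ?_ (disjUnion.inl_ne_inr _ _))
      rintro rfl
      exact hi (hx ▸ hy)
    · refine fibers.mk_eq_iff.trans (iff_of_false ?_ (disjUnion.inl_ne_inr _ _).symm)
      rintro rfl
      exact hi (hy ▸ hx)
    · exact (fibers.mk_eq_iff.trans fibers.mk_eq_iff.symm).trans disjUnion.inr_inj.symm
  · rintro a (⟨x, hx⟩ | ⟨x, hx⟩)
    · exact ⟨Sum.inl ⟨a • x, by rwa [hc]⟩, rfl, rfl⟩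
    · exact ⟨Sum.inr ⟨a • x, by rwa [hc]⟩, rfl, rfl⟩
  · rintro (x | x) <;> rfl
  · rintro (x | x) <;> rfl

end fibers

end GSpan

namespace Burnside

variable {P Q S T : GSetFraction.{u, v} R}

theorem of_empty : of (GSpan.empty P Q) = 0 := map_zero _

theorem of_disjUnion (U V : GSpan P Q) : of (GSpan.disjUnion U V) = of U + of V :=
  map_add Algebra.GrothendieckAddGroup.of (SpanClass.mk U) (SpanClass.mk V)

theorem of_eq_zero (U : GSpan P Q) (h : ∀ _ : U.carrier, False) : of U = 0 :=
  (of_eq (GSpan.equiv_empty_of_isEmpty U h)).trans of_empty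

/-- A span is the sum of the fibres of an invariant function. -/
theorem sum_of_fibers {ι : Type*} [Fintype ι] (U : GSpan P Q) (c : U.carrier → ι)
    (hc : ∀ (a : Q.grp × P.grp) x, c (a • x) = c x) :
    ∑ i, of (U.fibers c hc {i}) = of U := by
  classical
  -- Induction on the set of values; this is why `fibers` takes a set and not a single value.
  have key : ∀ t : Finset ι, ∑ i ∈ t, of (U.fibers c hc {i}) = of (U.fibers c hc t) := by
    intro t
    induction t using Finset.induction_on with
    | empty =>
      rw [Finset.sum_empty, Finset.coe_empty, of_eq GSpan.fibers_empty, of_empty]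
    | insert i t hi ih =>
      rw [Finset.sum_insert hi, ih, Finset.coe_insert, of_eq (GSpan.fibers_insert (by simpa)),
        of_disjUnion]
  rw [key, Finset.coe_univ, of_eq GSpan.fibers_univ]

end Burnside

/-! ### Full embeddings of action groupoids and their spans -/

/-- A fully faithful functor between action groupoids: an injective group homomorphism with an
equivariant map of points, such that every group element that carries `f x` to `f y` comes from one
that carries `x` to `y`. -/
structure FullEmbedding (P Q : GSetFraction.{u, v} R) where
  hom : P.grp →* Q.grp
  map : P.pts → Q.pts
  map_smul : ∀ g x, map (g • x) = hom g • map x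
  injective : Function.Injective hom
  full : ∀ x y h, h • map x = map y → ∃ g, hom g = h ∧ g • x = y

namespace FullEmbedding

variable {P P' Q : GSetFraction.{u, v} R}

/-- The covariant span of a full embedding. -/
def push (F : FullEmbedding P Q) : GSpan P Q where
  carrier := Q.grp × P.pts
  act :=
    { smul := fun a z => (a.1 * z.1 * (F.hom a.2)⁻¹, a.2 • z.2)
      one_smul := by
        rintro ⟨a, x⟩
        change ((1 : Q.grp) * a * (F.hom 1)⁻¹, (1 : P.grp) • x) = _
        simp
      mul_smul := by
        rintro ⟨a, b⟩ ⟨c, d⟩ ⟨h, x⟩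
        change ((a * c) * h * (F.hom (b * d))⁻¹, (b * d) • x) =
          (a * (c * h * (F.hom d)⁻¹) * (F.hom b)⁻¹, b • d • x)
        rw [mul_smul, map_mul, mul_inv_rev]
        simp only [mul_assoc] }
  left z := z.1 • F.map z.2
  right z := z.2
  left_smul := by
    rintro ⟨a, b⟩ ⟨h, x⟩
    change (a * h * (F.hom b)⁻¹) • F.map (b • x) = a • h • F.map x
    simp [F.map_smul, smul_smul]
  right_smul _ _ := rfl

/-- The contravariant span of a full embedding. -/
def pull (F : FullEmbedding P Q) : GSpan Q P where
  carrier := F.push.carrier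
  act :=
    { smul := fun a z => (a.2, a.1) • z
      one_smul := fun z => one_smul (Q.grp × P.grp) z
      mul_smul := fun a b z => mul_smul (a.2, a.1) (b.2, b.1) z }
  left := F.push.right
  right := F.push.left
  left_smul a z := F.push.right_smul (a.2, a.1) z
  right_smul a z := F.push.left_smul (a.2, a.1) z

def pushMk (F : FullEmbedding P Q) (h : Q.grp) (x : P.pts) : F.push.carrier := (h, x)

def pullMk (F : FullEmbedding P Q) (h : Q.grp) (x : P.pts) : F.pull.carrier := (h, x)

variable (F : FullEmbedding P Q)

theorem push_exists_rep (z : F.push.carrier) : ∃ h x, z = F.pushMk h x := ⟨z.1, z.2, rfl⟩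

theorem pull_exists_rep (z : F.pull.carrier) : ∃ h x, z = F.pullMk h x := ⟨z.1, z.2, rfl⟩

variable {F}

theorem pushMk_eq_iff {h h' : Q.grp} {x x' : P.pts} :
    F.pushMk h x = F.pushMk h' x' ↔ h = h' ∧ x = x' := Prod.ext_iff

theorem pullMk_eq_iff {h h' : Q.grp} {x x' : P.pts} :
    F.pullMk h x = F.pullMk h' x' ↔ h = h' ∧ x = x' := Prod.ext_iff

theorem smul_pushMk (a : Q.grp) (b : P.grp) (h : Q.grp) (x : P.pts) :
    (a, b) • F.pushMk h x = F.pushMk (a * h * (F.hom b)⁻¹) (b • x) := rfl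

theorem smul_pullMk (a : Q.grp) (b : P.grp) (h : Q.grp) (x : P.pts) :
    (b, a) • F.pullMk h x = F.pullMk (a * h * (F.hom b)⁻¹) (b • x) := rfl

theorem push_left (h : Q.grp) (x : P.pts) : F.push.left (F.pushMk h x) = h • F.map x := rfl

theorem push_right (h : Q.grp) (x : P.pts) : F.push.right (F.pushMk h x) = x := rfl

theorem pull_left (h : Q.grp) (x : P.pts) : F.pull.left (F.pullMk h x) = x := rfl

theorem pull_right (h : Q.grp) (x : P.pts) : F.pull.right (F.pullMk h x) = h • F.map x := rfl

/-- This is full faithfulness. A class `[(b, y), (a, x)]` satisfies `b • F y = a • F x`, so `b⁻¹ a`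
carries `F x` to `F y` and comes from a unique `g` with `g • x = y`. The middle group normalizes `b`
to `1`, which leaves just the pair `(g, y)`. -/
theorem pull_comp_push : GSpan.comp F.pull F.push ≈ GSpan.ident P := by
  refine GSpan.Equivalence.nonempty_of_surjective (E := P.grp × P.pts)
    (fun e => GSpan.comp.mk (F.pullMk 1 e.2) (F.pushMk (F.hom e.1) (e.1⁻¹ • e.2)) (by
      rw [pull_right, push_left, ← F.map_smul, smul_inv_smul, one_smul]))
    (fun e => GSpan.ident.mk e.1 e.2) ?_ ?_ ?_ ?_ ?_ ?_
  · intro z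
    obtain ⟨v, u, h, rfl⟩ := GSpan.comp.exists_rep z
    obtain ⟨b, y, rfl⟩ := F.pull_exists_rep v
    obtain ⟨a, x, rfl⟩ := F.push_exists_rep u
    rw [pull_right, push_left] at h
    obtain ⟨g, hg, rfl⟩ := F.full x y (b⁻¹ * a) (by rw [mul_smul, ← h, inv_smul_smul])
    refine ⟨(g, g • x), ?_⟩
    simp only [GSpan.comp.mk_eq_iff, smul_pullMk, smul_pushMk, pullMk_eq_iff, pushMk_eq_iff]
    exact ⟨b, by simp, by simp [hg]⟩
  · intro z
    obtain ⟨g, x, rfl⟩ := GSpan.ident.exists_rep z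
    exact ⟨(g, x), rfl⟩
  · rintro ⟨g, x⟩ ⟨g', x'⟩
    simp only [GSpan.comp.mk_eq_iff, smul_pullMk, smul_pushMk, pullMk_eq_iff, pushMk_eq_iff,
      GSpan.ident.mk_eq_iff]
    constructor
    · rintro ⟨a, ⟨h₁, h₂⟩, h₃, -⟩
      obtain rfl : a = 1 := by simpa using h₁
      exact ⟨F.injective (by simpa using h₃), by simpa using h₂⟩
    · rintro ⟨rfl, rfl⟩
      exact ⟨1, by simp⟩
  · rintro ⟨k, k'⟩ ⟨g, x⟩
    refine ⟨(k * g * k'⁻¹, k • x), ?_, rfl⟩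
    simp only [GSpan.comp.smul_mk, GSpan.comp.mk_eq_iff, smul_pullMk, smul_pushMk, pullMk_eq_iff,
      pushMk_eq_iff]
    -- Acting by `k` turns the normalized first coordinate `1` into `(F.hom k)⁻¹`; the middle group
    -- makes up for it.
    exact ⟨(F.hom k)⁻¹, by simp, by simp [mul_assoc], by simp [mul_smul]⟩
  · rintro ⟨g, x⟩
    rfl
  · rintro ⟨g, x⟩
    rfl

/-- If no orbit meets both images, the pullback is empty; this gives the off-diagonal zeros of the
biproduct. -/
theorem pull_comp_push_isEmpty {F' : FullEmbedding P' Q}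
    (h : ∀ (a b : Q.grp) x y, a • F.map x ≠ b • F'.map y)
    (z : (GSpan.comp F'.pull F.push).carrier) : False := by
  obtain ⟨v, u, hz, rfl⟩ := GSpan.comp.exists_rep z
  exact h _ _ _ _ hz.symm

/-- Elements of the composite are classes `[(a, x), (b, x)]`, and `(a b⁻¹, a • F x)` is a complete
invariant by fullness. The idempotent attached to `F` is thus the part of the identity over the
points of index `i`, and these parts add up to the identity as `i` varies. -/
theorem push_comp_pull {ι : Type*} (c : Q.pts → ι) (hc : ∀ (h : Q.grp) y, c (h • y) = c y) (i : ι)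
    (hF : ∀ x, c (F.map x) = i) (hF' : ∀ y, c y = i → ∃ (h : Q.grp) (x : P.pts), h • F.map x = y) :
    GSpan.comp F.push F.pull ≈
      (GSpan.ident Q).fibers (fun z => c ((GSpan.ident Q).left z))
        (fun a z => by rw [GSpan.left_smul, hc]) {i} := by
  refine GSpan.Equivalence.nonempty_of_surjective (E := Q.grp × Q.grp × P.pts)
    (fun e => GSpan.comp.mk (F.pushMk e.1 e.2.2) (F.pullMk e.2.1 e.2.2)
      ((push_right _ _).trans (pull_left _ _).symm))
    (fun e => GSpan.fibers.mk (GSpan.ident.mk (e.1 * e.2.1⁻¹) (e.1 • F.map e.2.2)) (by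
      rw [GSpan.ident.left_mk, hc, hF]
      rfl)) ?_ ?_ ?_ ?_ ?_ ?_
  · intro z
    obtain ⟨u, v, h, rfl⟩ := GSpan.comp.exists_rep z
    obtain ⟨a, x, rfl⟩ := F.push_exists_rep u
    obtain ⟨b, y, rfl⟩ := F.pull_exists_rep v
    obtain rfl : x = y := h
    exact ⟨(a, b, x), rfl⟩
  · intro z
    obtain ⟨t, ht, rfl⟩ := GSpan.fibers.exists_rep z
    obtain ⟨h, y, rfl⟩ := GSpan.ident.exists_rep t
    obtain ⟨a, x, rfl⟩ := hF' y ht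
    -- The second entry `b` is forced by `a b⁻¹ = h`.
    refine ⟨(a, h⁻¹ * a, x), ?_⟩
    simp only [GSpan.fibers.mk_eq_iff, GSpan.ident.mk_eq_iff]
    simp
  · rintro ⟨a, b, x⟩ ⟨a', b', x'⟩
    simp only [GSpan.comp.mk_eq_iff, smul_pullMk, smul_pushMk, pullMk_eq_iff, pushMk_eq_iff,
      GSpan.fibers.mk_eq_iff, GSpan.ident.mk_eq_iff]
    constructor
    · rintro ⟨g, ⟨rfl, rfl⟩, rfl, -⟩
      simp [F.map_smul, smul_smul]
    · rintro ⟨h₁, h₂⟩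
      -- The element that identifies the two representatives must lift `a'⁻¹ a`, which carries `F x`
      -- to `F x'`.
      obtain ⟨g, hg, rfl⟩ := F.full x x' (a'⁻¹ * a) (by rw [mul_smul, h₂, inv_smul_smul])
      refine ⟨g, ⟨by simp [hg], rfl⟩, ?_, rfl⟩
      rw [hg, one_mul, mul_inv_rev, inv_inv, ← mul_assoc, ← inv_inj, ← mul_right_inj a', ← h₁]
      simp [mul_assoc]
  · rintro ⟨k, k'⟩ ⟨a, b, x⟩
    refine ⟨(k * a, k' * b, x), ?_, ?_⟩
    · simp [GSpan.comp.smul_mk, smul_pullMk, smul_pushMk]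
    · simp only [GSpan.fibers.smul_mk, GSpan.fibers.mk_eq_iff, GSpan.ident.smul_mk,
        GSpan.ident.mk_eq_iff]
      simp [mul_assoc, mul_smul]
  · rintro ⟨a, b, x⟩
    rfl
  · rintro ⟨a, b, x⟩
    change (a * b⁻¹)⁻¹ • a • F.map x = b • F.map x
    simp [smul_smul]

end FullEmbedding

end GSetFraction

/-! ### Additive structure and biproduct decompositions -/

namespace GSetFraction

variable {R : Type v} [CommRing R]

theorem Mor.comp_tmul_one {P Q T : GSetFraction.{u, v} R} (y : Burnside Q T) (x : Burnside P Q) :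
    Mor.comp ((1 : R) ⊗ₜ[ℤ] y) ((1 : R) ⊗ₜ[ℤ] x) = (1 : R) ⊗ₜ[ℤ] Burnside.comp P Q T y x := by
  rw [Mor.comp_tmul, one_mul]

instance (P Q : GSetFraction.{u, v} R) : AddCommGroup (P ⟶ Q) :=
  inferInstanceAs (AddCommGroup (Mor P Q))

noncomputable instance preadditive : Preadditive (GSetFraction.{u, v} R) where
  homGroup _ _ := inferInstance
  add_comp _ _ _ f f' g := Mor.comp_add g f f'
  comp_add _ _ _ f g g' := Mor.add_comp g g' f

/-- The morphism `1 ⊗ ⟨U⟩`. -/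
noncomputable def spanHom {P Q : GSetFraction.{u, v} R} (U : GSpan P Q) : P ⟶ Q :=
  (1 : R) ⊗ₜ[ℤ] Burnside.of U

section

variable {P Q T : GSetFraction.{u, v} R}

theorem spanHom_comp (U : GSpan P Q) (V : GSpan Q T) :
    spanHom U ≫ spanHom V = spanHom (GSpan.comp V U) := by
  refine (Mor.comp_tmul_one _ _).trans ?_
  rw [Burnside.comp_of]
  rfl

theorem spanHom_eq {U V : GSpan P Q} (h : U ≈ V) : spanHom U = spanHom V :=
  congrArg (fun x => ((1 : R) ⊗ₜ[ℤ] x : Mor P Q)) (Burnside.of_eq h)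

theorem spanHom_eq_zero {U : GSpan P Q} (h : ∀ _ : U.carrier, False) : spanHom U = 0 :=
  (congrArg (fun x => ((1 : R) ⊗ₜ[ℤ] x : Mor P Q)) (Burnside.of_eq_zero U h)).trans
    (tmul_zero _ _)

theorem sum_spanHom_fibers {ι : Type*} [Fintype ι] (U : GSpan P Q) (c : U.carrier → ι)
    (hc : ∀ (a : Q.grp × P.grp) x, c (a • x) = c x) :
    ∑ i, spanHom (U.fibers c hc {i}) = spanHom U := by
  refine Eq.trans ?_
    (congrArg (fun x => ((1 : R) ⊗ₜ[ℤ] x : Mor P Q)) (Burnside.sum_of_fibers U c hc))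
  exact (TensorProduct.tmul_sum (1 : R) Finset.univ _).symm

end

/-- A family of full embeddings into `Q` such that every point of `Q` is in the orbit of the image
of exactly one of them, namely the one with index `idx y`. -/
structure EmbeddingPartition {ι : Type*} (B : ι → GSetFraction.{u, v} R)
    (Q : GSetFraction.{u, v} R) where
  emb : ∀ i, FullEmbedding (B i) Q
  idx : Q.pts → ι
  idx_smul : ∀ (h : Q.grp) y, idx (h • y) = idx y
  idx_map : ∀ i x, idx ((emb i).map x) = i
  exists_map : ∀ y, ∃ (h : Q.grp) (x : (B (idx y)).pts), h • (emb (idx y)).map x = y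

namespace EmbeddingPartition

variable {ι : Type*} {B : ι → GSetFraction.{u, v} R} {Q : GSetFraction.{u, v} R}

open Classical in
/-- A partition into full embeddings is a biproduct decomposition. -/
noncomputable def bicone (E : EmbeddingPartition B Q) : Limits.Bicone B where
  pt := Q
  π i := spanHom (E.emb i).pull
  ι i := spanHom (E.emb i).push
  ι_π i j := by
    rw [spanHom_comp]
    split_ifs with h
    · subst h
      exact spanHom_eq FullEmbedding.pull_comp_push
    · refine spanHom_eq_zero (FullEmbedding.pull_comp_push_isEmpty fun a b x y hxy => h ?_)
      rw [← E.idx_map i x, ← E.idx_smul a, hxy, E.idx_smul, E.idx_map]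

/-- Every point of `Q` has exactly one index, so the parts of the identity span over the various
indices sum to the whole. -/
theorem bicone_total [Fintype ι] (E : EmbeddingPartition B Q) :
    ∑ i, E.bicone.π i ≫ E.bicone.ι i = 𝟙 E.bicone.pt := by
  refine Eq.trans (Finset.sum_congr rfl fun i _ => ?_)
    (sum_spanHom_fibers (GSpan.ident Q) (fun z => E.idx ((GSpan.ident Q).left z))
      fun a z => by rw [GSpan.left_smul, E.idx_smul])
  refine (spanHom_comp _ _).trans (spanHom_eq (FullEmbedding.push_comp_pull _ E.idx_smul i
    (E.idx_map i) fun y hy => ?_))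
  subst hy
  exact E.exists_map y

end EmbeddingPartition

/-- The fraction `•/K`. -/
def ofGroup (K : Type u) [Group K] [Finite K] : GSetFraction.{u, v} R where
  grp := K
  pts := PUnit
  act :=
    { smul := fun _ x => x
      one_smul := fun _ => rfl
      mul_smul := fun _ _ _ => rfl }

/-- The full embedding of `•/K` onto a point with stabilizer `K`. -/
def stabilizerEmbedding (Q : GSetFraction.{u, v} R) (y : Q.pts) {K : Type u} [Group K] [Finite K]
    (e : K ≃* MulAction.stabilizer Q.grp y) : FullEmbedding (ofGroup K : GSetFraction.{u, v} R) Q where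
  hom := (MulAction.stabilizer Q.grp y).subtype.comp e.toMonoidHom
  map _ := y
  map_smul g _ := ((e g).2 : (e g).1 • y = y).symm
  injective := Subtype.val_injective.comp e.injective
  full _ _ h hh := ⟨e.symm ⟨h, hh⟩, congrArg Subtype.val (e.apply_symm_apply ⟨h, hh⟩), rfl⟩

abbrev orbits (Q : GSetFraction.{u, v} R) : Type u := MulAction.orbitRel.Quotient Q.grp Q.pts

/-- The stabilizer of a representative of an orbit. -/
noncomputable abbrev orbitStabilizer (Q : GSetFraction.{u, v} R) (o : Q.orbits) : Subgroup Q.grp :=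
  MulAction.stabilizer Q.grp o.out

/-- A fraction is partitioned into its orbits. -/
noncomputable def orbitPartition (Q : GSetFraction.{u, v} R) {ι : Type*} (σ : ι ≃ Q.orbits)
    (K : ι → Type u) [∀ i, Group (K i)] [∀ i, Finite (K i)]
    (e : ∀ i, K i ≃* Q.orbitStabilizer (σ i)) :
    EmbeddingPartition (fun i => (ofGroup (K i) : GSetFraction.{u, v} R)) Q where
  emb i := stabilizerEmbedding Q (σ i).out (e i)
  idx y := σ.symm (Quotient.mk (MulAction.orbitRel Q.grp Q.pts) y)
  idx_smul h y := congrArg σ.symm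
    (Quotient.sound (s := MulAction.orbitRel Q.grp Q.pts) (MulAction.mem_orbit y h))
  idx_map i _ := σ.symm_apply_eq.2 (Quotient.out_eq (σ i))
  exists_map y := by
    obtain ⟨h, hh⟩ := Setoid.symm' _
      (Quotient.mk_out (s := MulAction.orbitRel Q.grp Q.pts) y)
    refine ⟨h, PUnit.unit, ?_⟩
    change h • (σ (σ.symm _)).out = y
    rw [Equiv.apply_symm_apply]
    exact hh

/-- The sum of two fractions is partitioned into its two summands. -/
def oplusPartition (P Q : GSetFraction.{u, v} R) :
    EmbeddingPartition (fun b : Bool => cond b P Q) (P.oplus Q) where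
  emb b := match b with
    | true =>
      { hom := MonoidHom.inl P.grp Q.grp
        -- `Q.grp` acts on the second coordinate by translation, so every orbit reaches the slice
        -- over `1`, and an element that preserves the slice has trivial `Q.grp`-component.
        map := fun x => Sum.inl (x, 1)
        map_smul := fun _ _ => congrArg Sum.inl (Prod.ext rfl (mul_one _).symm)
        injective := fun _ _ h => congrArg Prod.fst h
        full := by
          rintro x y ⟨g, k⟩ h
          have h' := Prod.ext_iff.1 (Sum.inl_injective h)
          exact ⟨g, Prod.ext rfl ((mul_one k).symm.trans h'.2).symm, h'.1⟩ }
    | false =>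
      { hom := MonoidHom.inr P.grp Q.grp
        map := fun y => Sum.inr (1, y)
        map_smul := fun _ _ => congrArg Sum.inr (Prod.ext (mul_one _).symm rfl)
        injective := fun _ _ h => congrArg Prod.snd h
        full := by
          rintro x y ⟨g, k⟩ h
          have h' := Prod.ext_iff.1 (Sum.inr_injective h)
          exact ⟨k, Prod.ext ((mul_one g).symm.trans h'.1).symm rfl, h'.2⟩ }
  idx := Sum.isLeft
  idx_smul := by
    rintro h (y | y) <;> rfl
  idx_map := by
    rintro (_ | _) x <;> rfl
  exists_map := by
    rintro (⟨x, k⟩ | ⟨g, y⟩)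
    · exact ⟨(1, k), x, congrArg Sum.inl (Prod.ext (one_smul _ x) (mul_one k))⟩
    · exact ⟨(g, 1), y, congrArg Sum.inr (Prod.ext (mul_one g) (one_smul _ y))⟩

/-- Fractions with partitions into the same summands are isomorphic. -/
theorem EmbeddingPartition.nonempty_iso {ι : Type*} [Finite ι] {B : ι → GSetFraction.{u, v} R}
    {Q S : GSetFraction.{u, v} R} (E : EmbeddingPartition B Q) (F : EmbeddingPartition B S) :
    Nonempty (Q ≅ S) := by
  have := Fintype.ofFinite ι
  have hE := Limits.isBilimitOfTotal _ E.bicone_total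
  have hF := Limits.isBilimitOfTotal _ F.bicone_total
  have : Limits.HasBiproduct B := Limits.HasBiproduct.mk ⟨E.bicone, hE⟩
  exact ⟨Limits.biproduct.uniqueUpToIso B hE ≪≫ (Limits.biproduct.uniqueUpToIso B hF).symm⟩

end GSetFraction

namespace GSetFraction

/-! ### Finite generation of Burnside groups -/

section FiniteGeneration

variable {R : Type v} {P Q : GSetFraction.{u, v} R}

/-- Orbit–stabilizer over `Y × X`: both spans are quotients of the group by the same subgroup, and
equivariant structure maps are fixed by their values at the base points. -/
theorem GSpan.equiv_of_stabilizer_eq {U V : GSpan P Q} (x : U.carrier) (y : V.carrier)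
    (hx : ∀ z, ∃ a : Q.grp × P.grp, a • x = z) (hy : ∀ z, ∃ a : Q.grp × P.grp, a • y = z)
    (hst : MulAction.stabilizer (Q.grp × P.grp) x = MulAction.stabilizer (Q.grp × P.grp) y)
    (hl : U.left x = V.left y) (hr : U.right x = V.right y) : U ≈ V := by
  refine Equivalence.nonempty_of_surjective (E := Q.grp × P.grp) (fun a => a • x) (fun a => a • y)
    hx hy ?_ ?_ ?_ ?_
  · intro a b
    have := SetLike.ext_iff.1 hst (b⁻¹ * a)
    simpa only [MulAction.mem_stabilizer_iff, mul_smul, inv_smul_eq_iff] using this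
  · exact fun a b => ⟨a * b, mul_smul a b x, mul_smul a b y⟩
  · intro a
    rw [V.left_smul, U.left_smul, hl]
  · intro a
    rw [V.right_smul, U.right_smul, hr]

/-- The classes of the transitive spans. -/
def transitiveClasses (P Q : GSetFraction.{u, v} R) : Set (Burnside P Q) :=
  {z | ∃ (U : GSpan P Q) (x : U.carrier), (∀ y, ∃ a : Q.grp × P.grp, a • x = y) ∧
    Burnside.of U = z}

/-- A stabilizer and two image points determine a transitive span, and there are finitely many such
triples. -/
theorem finite_transitiveClasses : (transitiveClasses P Q).Finite := by
  have h : ∀ z : transitiveClasses P Q, ∃ (U : GSpan P Q) (x : U.carrier),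
    (∀ y, ∃ a : Q.grp × P.grp, a • x = y) ∧ Burnside.of U = z.1 := fun z => z.2
  choose U x hx hU using h
  refine Finite.of_injective (β := Subgroup (Q.grp × P.grp) × Q.pts × P.pts)
    (fun z => (MulAction.stabilizer _ (x z), (U z).left (x z), (U z).right (x z))) fun z w hzw => ?_
  simp only [Prod.mk.injEq] at hzw
  apply Subtype.ext
  rw [← hU, ← hU]
  exact Burnside.of_eq
    (GSpan.equiv_of_stabilizer_eq (x z) (x w) (hx z) (hx w) hzw.1 hzw.2.1 hzw.2.2)

/-- Every span is the sum of its orbits, which are the fibres of the orbit map. -/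
theorem closure_transitiveClasses :
    AddSubgroup.closure (transitiveClasses P Q) = ⊤ := by
  refine eq_top_iff.2 fun z _ => ?_
  induction z using Burnside.induction with
  | hsub z w hz hw => exact sub_mem (hz trivial) (hw trivial)
  | hof U =>
    have := Fintype.ofFinite (MulAction.orbitRel.Quotient (Q.grp × P.grp) U.carrier)
    have hc : ∀ (a : Q.grp × P.grp) x, Quotient.mk (MulAction.orbitRel (Q.grp × P.grp) U.carrier)
        (a • x) = Quotient.mk _ x := fun a x =>
      Quotient.sound (s := MulAction.orbitRel (Q.grp × P.grp) U.carrier) (MulAction.mem_orbit x a)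
    rw [← Burnside.sum_of_fibers U _ hc]
    refine sum_mem fun o _ => AddSubgroup.subset_closure ?_
    obtain ⟨x, rfl⟩ := Quotient.exists_rep o
    refine ⟨_, GSpan.fibers.mk x (Set.mem_singleton _), fun z => ?_, rfl⟩
    obtain ⟨y, hy, rfl⟩ := GSpan.fibers.exists_rep z
    obtain ⟨a, ha⟩ := Quotient.exact hy
    exact ⟨a, by rw [GSpan.fibers.smul_mk, GSpan.fibers.mk_eq_iff]; exact ha⟩

end FiniteGeneration

/-! ### Counting twisted orbits -/

section TwistedOrbits

variable {R : Type v} {P Q : GSetFraction.{u, v} R}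

namespace GSpan

/-- The stabilizer of `x` projects onto the left factor, which meets it trivially. -/
def IsTwisted {U : GSpan P P} (x : U.carrier) : Prop :=
  (∀ k : P.grp, ∃ k' : P.grp, (k, k') • x = x) ∧ ∀ k : P.grp, (k, (1 : P.grp)) • x = x → k = 1

/-- By finiteness, a stabilizer as in `IsTwisted` is the graph of an automorphism of `P.grp`. Orbits
are counted, not points, so that the identity of `•/K` counts one. -/
def twistedOrbits (U : GSpan P P) : Set (Set U.carrier) :=
  (fun x => MulAction.orbit (P.grp × P.grp) x) '' {x | IsTwisted x}

theorem isTwisted_map_iff {U V : GSpan P P} {j : U.carrier → V.carrier}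
    (hj : Function.Injective j) (hs : ∀ (a : P.grp × P.grp) x, j (a • x) = a • j x)
    (x : U.carrier) : IsTwisted (j x) ↔ IsTwisted x := by
  simp only [IsTwisted, ← hs, hj.eq_iff]

theorem image_twistedOrbits {U V : GSpan P P} {j : U.carrier → V.carrier}
    (hs : ∀ (a : P.grp × P.grp) x, j (a • x) = a • j x) :
    (j '' ·) '' twistedOrbits U =
      (fun x => MulAction.orbit (P.grp × P.grp) x) '' (j '' {x | IsTwisted x}) := by
  simp only [twistedOrbits, Set.image_image]
  refine congrArg (· '' _) (funext fun x => ?_)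
  simp only [MulAction.orbit, ← Set.range_comp, Function.comp_def, hs]

theorem ncard_twistedOrbits_congr {U V : GSpan P P} (h : U ≈ V) :
    (twistedOrbits U).ncard = (twistedOrbits V).ncard := by
  obtain ⟨e⟩ := h
  rw [← Set.ncard_image_of_injective (twistedOrbits U)
    (Set.image_injective.2 e.toEquiv.injective), image_twistedOrbits e.map_smul, twistedOrbits]
  congr 2
  ext y
  obtain ⟨x, rfl⟩ := e.toEquiv.surjective y
  rw [e.toEquiv.injective.mem_set_image]
  exact (isTwisted_map_iff e.toEquiv.injective e.map_smul x).symm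

/-- Each orbit lies in one summand and keeps its stabilizers there. Additivity is what extends the
count to the Burnside group. -/
theorem ncard_twistedOrbits_disjUnion (U V : GSpan P P) :
    (twistedOrbits (disjUnion U V)).ncard =
      (twistedOrbits U).ncard + (twistedOrbits V).ncard := by
  have hl : Function.Injective (disjUnion.inl : U.carrier → (disjUnion U V).carrier) :=
    fun _ _ => disjUnion.inl_inj.1
  have hr : Function.Injective (disjUnion.inr : V.carrier → (disjUnion U V).carrier) :=
    fun _ _ => disjUnion.inr_inj.1
  have key : twistedOrbits (disjUnion U V) =
      (disjUnion.inl '' ·) '' twistedOrbits U ∪ (disjUnion.inr '' ·) '' twistedOrbits V := by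
    rw [image_twistedOrbits disjUnion.smul_inl, image_twistedOrbits disjUnion.smul_inr,
      ← Set.image_union, twistedOrbits]
    congr 1
    ext z
    obtain ⟨x, rfl⟩ | ⟨x, rfl⟩ := disjUnion.exists_rep z
    · simp [hl.eq_iff, isTwisted_map_iff hl disjUnion.smul_inl,
        (disjUnion.inl_ne_inr _ _).symm]
    · simp [hr.eq_iff, isTwisted_map_iff hr disjUnion.smul_inr, disjUnion.inl_ne_inr]
  rw [key, Set.ncard_union_eq, Set.ncard_image_of_injective _ (Set.image_injective.2 hl),
    Set.ncard_image_of_injective _ (Set.image_injective.2 hr)]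
  -- A common member of the two families would have to be empty, and orbits are not.
  · rw [Set.disjoint_left]
    rintro _ ⟨s, ⟨x, -, rfl⟩, rfl⟩ ⟨t, -, ht⟩
    obtain ⟨y, -, hy⟩ : disjUnion.inl x ∈ disjUnion.inr '' t := by
      rw [show disjUnion.inr '' t = _ from ht]
      exact Set.mem_image_of_mem _ (MulAction.mem_orbit_self x)
    exact disjUnion.inl_ne_inr _ _ hy.symm

theorem ncard_twistedOrbits_eq_zero {U : GSpan P P} (h : ∀ x : U.carrier, ¬ IsTwisted x) :
    (twistedOrbits U).ncard = 0 := by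
  rw [twistedOrbits, show {x : U.carrier | IsTwisted x} = ∅ from Set.eq_empty_of_forall_notMem h,
    Set.image_empty, Set.ncard_empty]

/-- A twisted orbit that factors through a group of at most the same order forces the two groups to
be isomorphic. -/
theorem nonempty_mulEquiv_of_isTwisted {V : GSpan Q P} {U : GSpan P Q} (z : (comp V U).carrier)
    (hz : IsTwisted z) (hcard : Nat.card Q.grp ≤ Nat.card P.grp) :
    Nonempty (P.grp ≃* Q.grp) := by
  obtain ⟨v, u, h, rfl⟩ := comp.exists_rep z
  -- `D` consists of the `(k, g)` that fix `v` and for which some `(g, k')` fixes `u`. If `(k, k')`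
  -- fixes `[v, u]`, the middle element `g` that witnesses this puts `(k, g)` in `D`, so `D`
  -- projects onto `P.grp`. If `(k, 1)` is in `D`, then `(k, 1)` fixes `[v, u]` and `k = 1`, so `D`
  -- embeds in `Q.grp`.
  let D : Subgroup (P.grp × Q.grp) := MulAction.stabilizer (P.grp × Q.grp) v ⊓
    ((MulAction.stabilizer (Q.grp × P.grp) u).map (MonoidHom.fst _ _)).comap (MonoidHom.snd _ _)
  let p : D →* P.grp := (MonoidHom.fst _ _).comp D.subtype
  let q : D →* Q.grp := (MonoidHom.snd _ _).comp D.subtype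
  have hp : Function.Surjective p := by
    intro k
    obtain ⟨k', hk⟩ := hz.1 k
    rw [comp.smul_mk, comp.mk_eq_iff] at hk
    obtain ⟨g, hg, hg'⟩ := hk
    refine ⟨⟨(k, g), ?_, ⟨(g, k'), ?_, rfl⟩⟩, rfl⟩
    · simpa [smul_smul] using hg
    · simpa [smul_smul] using hg'
  have hq : Function.Injective q := by
    rw [injective_iff_map_eq_one]
    rintro ⟨⟨k, g⟩, hv, -⟩ (rfl : g = 1)
    have hk : k = 1 := hz.2 k (by
      rw [comp.smul_mk, comp.mk_eq_iff]
      exact ⟨1, (one_smul (P.grp × Q.grp) _).trans hv,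
        (one_smul (Q.grp × P.grp) _).trans (one_smul (Q.grp × P.grp) _)⟩)
    subst hk
    rfl
  have h₁ := Nat.card_le_card_of_surjective p hp
  have h₂ := Nat.card_le_card_of_injective q hq
  -- `|P.grp| ≤ |D| ≤ |Q.grp| ≤ |P.grp|`, so both projections are bijective.
  have hp' := (Nat.bijective_iff_surjective_and_card p).2 ⟨hp, by omega⟩
  have hq' := (Nat.bijective_iff_injective_and_card q).2 ⟨hq, by omega⟩
  exact ⟨(MulEquiv.ofBijective p hp').symm.trans (MulEquiv.ofBijective q hq')⟩

end GSpan

/-- The number of twisted orbits. -/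
noncomputable def twistedCount (P : GSetFraction.{u, v} R) : Burnside P P →+ ℤ :=
  Algebra.GrothendieckAddGroup.lift
    { toFun := Quotient.lift (fun U => ((GSpan.twistedOrbits U).ncard : ℤ))
        fun _ _ h => congrArg _ (GSpan.ncard_twistedOrbits_congr h)
      map_zero' := congrArg _ (GSpan.ncard_twistedOrbits_eq_zero fun x => PEmpty.elim x)
      map_add' := by
        rintro ⟨U⟩ ⟨V⟩
        exact (congrArg _ (GSpan.ncard_twistedOrbits_disjUnion U V)).trans (Nat.cast_add _ _) }

theorem twistedCount_of (U : GSpan P P) :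
    twistedCount P (Burnside.of U) = (GSpan.twistedOrbits U).ncard :=
  Burnside.lift_of _ _

end TwistedOrbits

variable {R : Type v}

/-- The identity biset is a single orbit, and its point over `1` has the diagonal as stabilizer. -/
theorem twistedCount_ident_ofGroup (K : Type u) [Group K] [Finite K] :
    twistedCount (ofGroup K : GSetFraction.{u, v} R) (Burnside.of (GSpan.ident _)) = 1 := by
  rw [twistedCount_of]
  suffices h : GSpan.twistedOrbits (GSpan.ident (ofGroup K : GSetFraction.{u, v} R)) =
      {Set.univ} by rw [h, Set.ncard_singleton, Nat.cast_one]
  have horb : ∀ x : (GSpan.ident (ofGroup K : GSetFraction.{u, v} R)).carrier,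
      MulAction.orbit ((ofGroup K : GSetFraction.{u, v} R).grp ×
        (ofGroup K : GSetFraction.{u, v} R).grp) x = Set.univ := by
    refine fun x => Set.eq_univ_of_forall fun y => ?_
    obtain ⟨g, p, rfl⟩ := GSpan.ident.exists_rep x
    obtain ⟨h, q, rfl⟩ := GSpan.ident.exists_rep y
    refine ⟨(h * g⁻¹, 1), ?_⟩
    change (h * g⁻¹, (1 : (ofGroup K : GSetFraction.{u, v} R).grp)) • GSpan.ident.mk g p = _
    rw [GSpan.ident.smul_mk, GSpan.ident.mk_eq_iff]
    exact ⟨by simp, rfl⟩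
  have htw : ∀ p : (ofGroup K : GSetFraction.{u, v} R).pts,
      GSpan.IsTwisted (GSpan.ident.mk 1 p) := by
    refine fun p => ⟨fun k => ⟨k, ?_⟩, fun k hk => ?_⟩
    · rw [GSpan.ident.smul_mk, GSpan.ident.mk_eq_iff]
      exact ⟨by simp, rfl⟩
    · rw [GSpan.ident.smul_mk, GSpan.ident.mk_eq_iff] at hk
      simpa using hk.1
  ext s
  constructor
  · rintro ⟨x, -, rfl⟩
    exact horb x
  · rintro rfl
    exact ⟨_, htw PUnit.unit, horb _⟩

theorem twistedCount_comp_eq_zero {P Q : GSetFraction.{u, v} R}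
    (hcard : Nat.card Q.grp ≤ Nat.card P.grp) (h : IsEmpty (P.grp ≃* Q.grp))
    (y : Burnside Q P) (x : Burnside P Q) : twistedCount P (Burnside.comp P Q P y x) = 0 := by
  induction y using Burnside.induction with
  | hsub y y' hy hy' => rw [map_sub, AddMonoidHom.sub_apply, map_sub, hy, hy', sub_zero]
  | hof V =>
    induction x using Burnside.induction with
    | hsub x x' hx hx' => rw [map_sub, map_sub, hx, hx', sub_zero]
    | hof U =>
      rw [Burnside.comp_of, twistedCount_of, GSpan.ncard_twistedOrbits_eq_zero, Nat.cast_zero]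
      exact fun z hz => not_isEmpty_iff.2 (GSpan.nonempty_mulEquiv_of_isTwisted z hz hcard) h

end GSetFraction

/-! ### The rank of a pairing in a preadditive category -/

section PairingSpan

variable {C : Type*} [Category* C] [Preadditive C] {k : Type*} [Field k] {K : C}

/-- The pairing `(f, g) ↦ e (f ≫ g)` induced by a functional on the endomorphisms of `K`. -/
def endPairing (e : (K ⟶ K) →+ k) (X : C) : (K ⟶ X) →+ (X ⟶ K) →+ k where
  toFun f := e.comp (Preadditive.leftComp K f)
  map_zero' := AddMonoidHom.ext fun g => by simp [Preadditive.leftComp]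
  map_add' f f' := AddMonoidHom.ext fun g => by simp [Preadditive.leftComp]

/-- The span of the functionals on `X ⟶ K` given by the pairing. Its dimension is the rank of the
pairing. -/
def endPairingSpan (e : (K ⟶ K) →+ k) (X : C) : Submodule k ((X ⟶ K) →+ k) :=
  Submodule.span k (Set.range (endPairing e X))

variable (k K) in
/-- Functionals are covariant in the object. -/
def functionalMap {X Y : C} (f : X ⟶ Y) : ((X ⟶ K) →+ k) →ₗ[k] ((Y ⟶ K) →+ k) where
  toFun w := w.comp (Preadditive.leftComp K f)
  map_add' _ _ := rfl
  map_smul' _ _ := rfl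

/-- Associativity of composition; hence `f` carries the pairing span of `X` into that of `Y`. -/
theorem functionalMap_endPairing (e : (K ⟶ K) →+ k) {X Y : C} (f : X ⟶ Y) (a : K ⟶ X) :
    functionalMap k K f (endPairing e X a) = endPairing e Y (a ≫ f) := by
  ext g
  simp [functionalMap, endPairing, Preadditive.leftComp]

/-- The pairing span is functorial. -/
def endPairingSpan.map (e : (K ⟶ K) →+ k) {X Y : C} (f : X ⟶ Y) :
    endPairingSpan e X →ₗ[k] endPairingSpan e Y :=
  (functionalMap k K f).restrict (p := endPairingSpan e X) (q := endPairingSpan e Y) (by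
    refine fun w hw => (Submodule.span_le (p := (endPairingSpan e Y).comap _)).2 ?_ hw
    rintro _ ⟨a, rfl⟩
    exact Submodule.subset_span ⟨_, (functionalMap_endPairing e f a).symm⟩)

variable (e : (K ⟶ K) →+ k)

theorem endPairingSpan.map_apply {X Y : C} (f : X ⟶ Y) (w : endPairingSpan e X) (g : Y ⟶ K) :
    (endPairingSpan.map e f w).1 g = w.1 (f ≫ g) := rfl

theorem endPairingSpan.ext {X : C} {w w' : endPairingSpan e X} (h : ∀ g, w.1 g = w'.1 g) :
    w = w' := Subtype.ext (AddMonoidHom.ext h)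

/-- The pairing span of a biproduct is the product of the pairing spans of the summands. -/
noncomputable def endPairingSpan.biconeEquiv {ι : Type*} [Fintype ι] {B : ι → C}
    (b : Limits.Bicone B) (hb : ∑ i, b.π i ≫ b.ι i = 𝟙 b.pt) :
    endPairingSpan e b.pt ≃ₗ[k] ∀ i, endPairingSpan e (B i) :=
  LinearEquiv.ofLinearMap (LinearMap.pi fun i => endPairingSpan.map e (b.π i))
    (∑ i, endPairingSpan.map e (b.ι i) ∘ₗ LinearMap.proj i)
    (by
      classical
      refine LinearMap.pi_ext' fun j => LinearMap.ext fun w => funext fun i =>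
        endPairingSpan.ext e fun g => ?_
      simp only [LinearMap.comp_apply, LinearMap.pi_apply, LinearMap.sum_apply, map_sum,
        LinearMap.proj_apply, LinearMap.single_apply, LinearMap.id_apply]
      -- Only the term at `j` survives on the `j`-th factor, and `ι j ≫ π i` is the identity or
      -- zero.
      rw [Finset.sum_eq_single j]
      · rw [Pi.single_eq_same, endPairingSpan.map_apply, endPairingSpan.map_apply]
        obtain rfl | h := eq_or_ne i j
        · rw [Pi.single_eq_same, Limits.bicone_ι_π_self_assoc]
        · rw [Pi.single_eq_of_ne h, Limits.bicone_ι_π_ne_assoc _ h.symm, Limits.zero_comp, map_zero]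
          rfl
      · intro l _ hl
        rw [Pi.single_eq_of_ne hl, map_zero, map_zero]
      · exact fun h => (h (Finset.mem_univ _)).elim)
    (by
      refine LinearMap.ext fun w => endPairingSpan.ext e fun g => ?_
      simp only [LinearMap.comp_apply, LinearMap.pi_apply, LinearMap.sum_apply,
        LinearMap.proj_apply, LinearMap.id_apply, AddSubmonoidClass.coe_finsetSum,
        AddMonoidHom.finsetSum_apply, endPairingSpan.map_apply]
      rw [← map_sum]
      -- Totality of the bicone splits `g` as the sum of the `π i ≫ ι i ≫ g`.
      conv_rhs => rw [← Category.id_comp g, ← hb, Preadditive.sum_comp]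
      simp only [Category.assoc])

/-- The rank of the pairing. -/
noncomputable def endPairingRank (X : C) : ℕ := Module.finrank k (endPairingSpan e X)

/-- Finite dimension is essential: `finrank` is zero on infinite-dimensional spaces, which would
break additivity. -/
theorem endPairingRank_bicone (hfin : ∀ X : C, Module.Finite k (endPairingSpan e X)) {ι : Type*}
    [Fintype ι] {B : ι → C} (b : Limits.Bicone B) (hb : ∑ i, b.π i ≫ b.ι i = 𝟙 b.pt) :
    endPairingRank e b.pt = ∑ i, endPairingRank e (B i) := by
  rw [endPairingRank, (endPairingSpan.biconeEquiv e b hb).finrank_eq]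
  have := fun i => hfin (B i)
  have := fun i => Module.Free.of_divisionRing k (endPairingSpan e (B i))
  exact Module.finrank_pi_fintype k

theorem endPairingRank_congr {X Y : C} (φ : X ≅ Y) : endPairingRank e X = endPairingRank e Y := by
  refine LinearEquiv.finrank_eq
    (LinearEquiv.ofLinearMap (endPairingSpan.map e φ.hom) (endPairingSpan.map e φ.inv) ?_ ?_)
  · refine LinearMap.ext fun w => endPairingSpan.ext e fun g => ?_
    simp [endPairingSpan.map_apply]
  · refine LinearMap.ext fun w => endPairingSpan.ext e fun g => ?_
    simp [endPairingSpan.map_apply]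

theorem endPairingRank_eq_zero {X : C} (h : ∀ (f : K ⟶ X) (g : X ⟶ K), e (f ≫ g) = 0) :
    endPairingRank e X = 0 := by
  have : endPairingSpan e X = ⊥ := by
    rw [endPairingSpan, Submodule.span_eq_bot]
    rintro _ ⟨f, rfl⟩
    exact AddMonoidHom.ext fun g => h f g
  rw [endPairingRank, this, finrank_bot]

/-- The functional attached to `𝟙 K` takes the nonzero value `e (𝟙 K)` at `𝟙 K`. -/
theorem endPairingRank_self_pos (hfin : Module.Finite k (endPairingSpan e K)) (h : e (𝟙 K) ≠ 0) :
    0 < endPairingRank e K := by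
  have : Nontrivial (endPairingSpan e K) := by
    refine Submodule.nontrivial_iff_ne_bot.2 fun hbot => h ?_
    have := (Submodule.span_eq_bot.1 hbot) _ ⟨𝟙 K, rfl⟩
    simpa [endPairing, Preadditive.leftComp] using DFunLike.congr_fun this (𝟙 K)
  exact Module.finrank_pos (R := k) (M := endPairingSpan e K)

end PairingSpan

/-! ### Multiplicities from triangular sums -/

section Triangular

/-- Two finite families with the same sums of a triangular family of functions are matched by a
bijection. -/
theorem multiset_eq_of_triangular {T : Type*} (deg : T → ℕ) (rank : T → T → ℕ)
    (hzero : ∀ a b, deg b ≤ deg a → b ≠ a → rank a b = 0) (hpos : ∀ a, 0 < rank a a)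
    (M M' : Multiset T) (h : ∀ a, (M.map (rank a)).sum = (M'.map (rank a)).sum) : M = M' := by
  classical
  by_contra hne
  obtain ⟨c, hc⟩ : ∃ c, M.count c ≠ M'.count c := by
    by_contra! hall
    exact hne (Multiset.ext.2 hall)
  let s := M.toFinset ∪ M'.toFinset
  have hs : ∀ c, M.count c ≠ M'.count c → c ∈ s := by
    intro c hc
    by_contra hcs
    simp only [s, Finset.mem_union, Multiset.mem_toFinset, not_or] at hcs
    exact hc (by rw [Multiset.count_eq_zero_of_notMem hcs.1, Multiset.count_eq_zero_of_notMem hcs.2])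
  have hsum : ∀ N : Multiset T, N.toFinset ⊆ s → ∀ a,
      (N.map (rank a)).sum = ∑ m ∈ s, N.count m * rank a m := by
    intro N hN a
    rw [Finset.sum_multiset_map_count]
    simp only [smul_eq_mul]
    refine Finset.sum_subset hN fun m _ hm => ?_
    rw [Multiset.count_eq_zero_of_notMem (by simpa using hm), zero_mul]
  -- Take `a` of largest degree among the elements whose multiplicities differ. Any other such
  -- element has degree at most `deg a`, so `rank a` kills it; the remaining ones contribute
  -- equally. Only the multiples of `rank a a` are left to compare.
  obtain ⟨a, ha, hmax⟩ := Finset.exists_max_image (s.filter fun c => M.count c ≠ M'.count c) deg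
    ⟨c, Finset.mem_filter.2 ⟨hs c hc, hc⟩⟩
  rw [Finset.mem_filter] at ha
  have h' := h a
  rw [hsum M Finset.subset_union_left, hsum M' Finset.subset_union_right,
    ← Finset.add_sum_erase _ _ ha.1, ← Finset.add_sum_erase _ _ ha.1] at h'
  have hrest : ∑ m ∈ s.erase a, M.count m * rank a m = ∑ m ∈ s.erase a, M'.count m * rank a m := by
    refine Finset.sum_congr rfl fun m hm => ?_
    rw [Finset.mem_erase] at hm
    by_cases hm' : M.count m = M'.count m
    · rw [hm']
    · rw [hzero a m (hmax m (Finset.mem_filter.2 ⟨hm.2, hm'⟩)) hm.1, mul_zero, mul_zero]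
  rw [hrest] at h'
  exact ha.2 (Nat.eq_of_mul_eq_mul_right (hpos a) (Nat.add_right_cancel h'))

/-- Equal multiplicities mean that corresponding fibres have the same size; fibrewise bijections
glue. -/
theorem exists_equiv_of_map_univ_eq {T α β : Type*} [Fintype α] [Fintype β] (t : α → T) (t' : β → T)
    (h : Finset.univ.val.map t = Finset.univ.val.map t') : ∃ σ : α ≃ β, ∀ a, t' (σ a) = t a := by
  classical
  have hcard : ∀ c, Nonempty ({a // t a = c} ≃ {b // t' b = c}) := by
    intro c
    have := congrArg (Multiset.count c) h
    rw [Multiset.count_map, Multiset.count_map] at this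
    refine ⟨Fintype.equivOfCardEq ?_⟩
    rw [Fintype.card_subtype, Fintype.card_subtype]
    simpa only [eq_comm, Finset.card_def, Finset.filter_val] using this
  exact ⟨Equiv.ofFiberEquiv fun c => (hcard c).some, Equiv.ofFiberEquiv_map _⟩

end Triangular

/-! ### Twisted ranks determine a fraction -/

namespace GSetFraction

section GrpClass

variable {R : Type v}

/-- The isomorphism relation on groups of fractions. -/
def grpSetoid (R : Type v) : Setoid (GSetFraction.{u, v} R) where
  r P Q := Nonempty (P.grp ≃* Q.grp)
  iseqv :=
    { refl := fun P => ⟨MulEquiv.refl P.grp⟩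
      symm := fun ⟨e⟩ => ⟨e.symm⟩
      trans := fun ⟨e⟩ ⟨f⟩ => ⟨e.trans f⟩ }

/-- Isomorphism classes of finite groups. -/
abbrev GrpClass (R : Type v) : Type _ := Quotient (grpSetoid.{u, v} R)

/-- The isomorphism class of the stabilizers in an orbit. -/
noncomputable def orbitClass (Q : GSetFraction.{u, v} R) (o : Q.orbits) : GrpClass.{u, v} R :=
  Quotient.mk (grpSetoid R) (ofGroup (Q.orbitStabilizer o))

/-- Replacing stabilizers by the chosen representative of their class makes orbits of the same
class, even in different fractions, give literally equal summands. -/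
theorem nonempty_mulEquiv_orbitClass (Q : GSetFraction.{u, v} R) (o : Q.orbits) :
    Nonempty ((Q.orbitClass o).out.grp ≃* Q.orbitStabilizer o) :=
  Quotient.mk_out (s := grpSetoid R) (ofGroup (Q.orbitStabilizer o) : GSetFraction.{u, v} R)

end GrpClass

variable {R : Type v} [CommRing R] {k : Type*} [Field k] (φ : R →+* k)

/-- The functional `r ⊗ x ↦ φ r * twistedCount x`. -/
noncomputable def twistedFunctional (P : GSetFraction.{u, v} R) : (P ⟶ P) →+ k :=
  (TensorProduct.lift (LinearMap.mk₂ ℤ (fun (r : R) x => φ r * (twistedCount P x : k))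
    (fun r r' x => by rw [map_add, add_mul])
    (fun n r x => by rw [map_zsmul, smul_mul_assoc])
    (fun r x x' => by rw [map_add, Int.cast_add, mul_add])
    (fun n r x => by rw [map_zsmul, smul_eq_mul, Int.cast_mul, zsmul_eq_mul, mul_left_comm])) :
      Mor P P →ₗ[ℤ] k).toAddMonoidHom

variable {φ} {P Q : GSetFraction.{u, v} R}

theorem twistedFunctional_tmul (r : R) (x : Burnside P P) :
    twistedFunctional φ P (r ⊗ₜ[ℤ] x : Mor P P) = φ r * (twistedCount P x : k) := rfl

theorem tmul_comp_tmul (r s : R) {T : GSetFraction.{u, v} R} (x : Burnside P Q)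
    (y : Burnside Q T) :
    (CategoryStruct.comp (r ⊗ₜ[ℤ] x : Mor P Q) (s ⊗ₜ[ℤ] y : Mor Q T) : P ⟶ T) =
      ((s * r) ⊗ₜ[ℤ] Burnside.comp P Q T y x : Mor P T) := rfl

theorem hom_induction {p : (P ⟶ Q) → Prop} (f : P ⟶ Q) (zero : p 0)
    (tmul : ∀ (r : R) (x : Burnside P Q), p (r ⊗ₜ[ℤ] x : Mor P Q))
    (add : ∀ f g, p f → p g → p (f + g)) : p f :=
  TensorProduct.induction_on f zero tmul add

/-- The functional is compatible with `φ`, so `r ⊗ x` pairs as `φ r` times `1 ⊗ x`. The finitely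
many transitive classes therefore span over `k`, whatever the size of `R`. -/
theorem endPairingSpan_finite (X : GSetFraction.{u, v} R) :
    Module.Finite k (endPairingSpan (twistedFunctional φ P) X) := by
  let η : Burnside P X →+ ((X ⟶ P) →+ k) := (endPairing (twistedFunctional φ P) X).comp
    (TensorProduct.mk ℤ R (Burnside P X) 1).toAddMonoidHom
  have hη : ∀ x, η x ∈ Submodule.span k (η '' transitiveClasses P X) := by
    intro x
    have hx : x ∈ AddSubgroup.closure (transitiveClasses P X) :=
      closure_transitiveClasses ▸ AddSubgroup.mem_top x
    induction hx using AddSubgroup.closure_induction with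
    | mem x hx => exact Submodule.subset_span ⟨x, hx, rfl⟩
    | zero => rw [map_zero]; exact zero_mem _
    | add x y _ _ hx hy => rw [map_add]; exact add_mem hx hy
    | neg x _ hx => rw [map_neg]; exact neg_mem hx
  have hle : endPairingSpan (twistedFunctional φ P) X ≤
      Submodule.span k (η '' transitiveClasses P X) := by
    refine Submodule.span_le.2 ?_
    rintro _ ⟨f, rfl⟩
    induction f using hom_induction with
    | zero => rw [map_zero]; exact zero_mem _
    | add f f' hf hf' => rw [map_add]; exact add_mem hf hf'
    | tmul r x =>
      suffices h : endPairing (twistedFunctional φ P) X (r ⊗ₜ[ℤ] x : Mor P X) = φ r • η x from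
        h ▸ Submodule.smul_mem _ (φ r) (hη x)
      refine AddMonoidHom.ext fun g => ?_
      change twistedFunctional φ P (_ ≫ g) = φ r * twistedFunctional φ P
        (CategoryStruct.comp (Y := X) ((1 : R) ⊗ₜ[ℤ] x : Mor P X) g)
      induction g using hom_induction with
      | zero => simp only [Limits.comp_zero, map_zero, mul_zero]
      | add g g' hg hg' => simp only [Preadditive.comp_add, map_add, mul_add, hg, hg']
      | tmul s y =>
        rw [tmul_comp_tmul, tmul_comp_tmul, twistedFunctional_tmul, twistedFunctional_tmul,
          mul_one, map_mul]
        ring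
  have := FiniteDimensional.span_of_finite k (finite_transitiveClasses (P := P) (Q := X) |>.image η)
  exact Submodule.finiteDimensional_of_le hle

variable (φ) in
/-- The rank of the twisted pairing with `•/K`. -/
noncomputable def twistedRank (K : Type u) [Group K] [Finite K] (X : GSetFraction.{u, v} R) : ℕ :=
  endPairingRank (twistedFunctional φ (ofGroup K)) X

/-- On pure tensors the pairing counts twisted orbits that factor through `G`, and there are none.
-/
theorem twistedRank_eq_zero {K G : Type u} [Group K] [Finite K] [Group G] [Finite G]
    (hcard : Nat.card G ≤ Nat.card K) (h : IsEmpty (K ≃* G)) :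
    twistedRank φ K (ofGroup G : GSetFraction.{u, v} R) = 0 := by
  refine endPairingRank_eq_zero _ fun f g => ?_
  induction f using hom_induction with
  | zero => rw [Limits.zero_comp, map_zero]
  | add f f' hf hf' => rw [Preadditive.add_comp, map_add, hf, hf', add_zero]
  | tmul r x =>
    induction g using hom_induction with
    | zero => rw [Limits.comp_zero, map_zero]
    | add g g' hg hg' => rw [Preadditive.comp_add, map_add, hg, hg', add_zero]
    | tmul s y =>
      rw [tmul_comp_tmul, twistedFunctional_tmul, twistedCount_comp_eq_zero hcard h, Int.cast_zero,
        mul_zero]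

theorem twistedRank_self_pos (K : Type u) [Group K] [Finite K] :
    0 < twistedRank φ K (ofGroup K : GSetFraction.{u, v} R) := by
  refine endPairingRank_self_pos _ (endPairingSpan_finite _) ?_
  have : twistedFunctional φ (ofGroup K) (𝟙 (ofGroup K : GSetFraction.{u, v} R)) = 1 := by
    refine (twistedFunctional_tmul _ _).trans ?_
    rw [twistedCount_ident_ofGroup, map_one, Int.cast_one, one_mul]
  rw [this]
  exact one_ne_zero

theorem EmbeddingPartition.twistedRank_eq {ι : Type*} [Fintype ι] {B : ι → GSetFraction.{u, v} R}
    (E : EmbeddingPartition B Q) (K : Type u) [Group K] [Finite K] :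
    twistedRank φ K Q = ∑ i, twistedRank φ K (B i) :=
  endPairingRank_bicone _ endPairingSpan_finite E.bicone E.bicone_total

theorem twistedRank_oplus (K : Type u) [Group K] [Finite K] :
    twistedRank φ K (P.oplus Q) = twistedRank φ K P + twistedRank φ K Q := by
  rw [(oplusPartition P Q).twistedRank_eq, Fintype.sum_bool]
  rfl

/-- Over a ring with a homomorphism to a field, fractions with the same twisted ranks are
isomorphic. -/
theorem nonempty_iso_of_twistedRank_eq {Q S : GSetFraction.{u, v} R}
    (h : ∀ (K : Type u) [Group K] [Finite K], twistedRank φ K Q = twistedRank φ K S) :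
    Nonempty (Q ≅ S) := by
  have := Fintype.ofFinite Q.orbits
  have := Fintype.ofFinite S.orbits
  let EQ := orbitPartition Q (Equiv.refl _) (fun o => (Q.orbitClass o).out.grp)
    fun o => (Q.nonempty_mulEquiv_orbitClass o).some
  let ES := orbitPartition S (Equiv.refl _) (fun o => (S.orbitClass o).out.grp)
    fun o => (S.nonempty_mulEquiv_orbitClass o).some
  let rank : GrpClass.{u, v} R → GrpClass.{u, v} R → ℕ := fun a b =>
    twistedRank φ a.out.grp (ofGroup b.out.grp : GSetFraction.{u, v} R)
  -- The degree is the group order; additivity over orbits turns equality of ranks into equality of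
  -- sums over the two multisets of stabilizer classes.
  have hM : Finset.univ.val.map Q.orbitClass = Finset.univ.val.map S.orbitClass := by
    refine multiset_eq_of_triangular (fun a => Nat.card a.out.grp) rank
      (fun a b hab hne => twistedRank_eq_zero hab ⟨fun e => hne ?_⟩)
      (fun a => twistedRank_self_pos _) _ _ fun a => ?_
    · rw [← Quotient.out_eq a, ← Quotient.out_eq b]
      exact Quotient.sound (s := grpSetoid R) ⟨e.symm⟩
    · rw [Multiset.map_map, Multiset.map_map]
      exact (EQ.twistedRank_eq _).symm.trans ((h _).trans (ES.twistedRank_eq _))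
  obtain ⟨σ, hσ⟩ := exists_equiv_of_map_univ_eq _ _ hM
  -- The orbits of `S` are reindexed by those of `Q` along `σ`, so that both partitions have the
  -- same family of summands.
  exact EQ.nonempty_iso (orbitPartition S σ (fun o => (Q.orbitClass o).out.grp)
    fun o => (hσ o ▸ S.nonempty_mulEquiv_orbitClass (σ o)).some)

end GSetFraction

/-- Cancellation law for the sum in `𝒞_R`. -/
theorem mainTheorem6 {R : Type v} [CommRing R] (P Q S : GSetFraction.{u, v} R)
    (h : Nonempty (P.oplus Q ≅ P.oplus S)) : Nonempty (Q ≅ S) := by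
  cases subsingleton_or_nontrivial R with
  | inl hR =>
    -- Over the zero ring all morphisms vanish, so any two objects are isomorphic.
    have hzero : ∀ (X Y : GSetFraction.{u, v} R) (f : X ⟶ Y), f = 0 := fun X Y f => by
      induction f using GSetFraction.hom_induction with
      | zero => rfl
      | tmul r x => exact Subsingleton.elim r 0 ▸ TensorProduct.zero_tmul _ x
      | add f g hf hg => rw [hf, hg, add_zero]
    exact ⟨⟨0, 0, (hzero _ _ _).trans (hzero _ _ _).symm, (hzero _ _ _).trans (hzero _ _ _).symm⟩⟩
  | inr hR =>
    -- The residue field at any maximal ideal supplies the field in which ranks are taken.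
    obtain ⟨m, hm⟩ := Ideal.exists_maximal R
    let _ := Ideal.Quotient.field m
    refine GSetFraction.nonempty_iso_of_twistedRank_eq (φ := Ideal.Quotient.mk m) fun K _ _ => ?_
    have hrank := endPairingRank_congr
      (GSetFraction.twistedFunctional (Ideal.Quotient.mk m) (GSetFraction.ofGroup K)) h.some
    exact Nat.add_left_cancel ((GSetFraction.twistedRank_oplus K).symm.trans
      (hrank.trans (GSetFraction.twistedRank_oplus K)))
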